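/- **Definitions.** For a matrix $H\in\mathbb F_2^{m\times n}$, the superimposed sum of a set of columns is their coordinatewise disjunction, and a column $a$ is contained in a column $b$ if $a\vee b=b$. $H$ is an $(m,n,d,x)$ X-code if the superimposed sum of any $x$ columns contains the $\mathbb F_2$-sum of no nonempty set of at most $d$ other columns; it has constant weight $3$ if every column has exactly three ones. A set $\mathcal B$ of triples ($3$-element subsets) of a point set $V$ with $|V|=m$ is identified with its point-by-block incidence matrix, which has $|\mathcal B|$ columns. The odd-point union of a set of triples is the set of points that lie in an odd number of them. Let $d\ge 2$. A $(d,2)$-forbidden configuration is a set $C$ of triples that contains two distinct triples $A_1,A_2$ such that $1\le|C\setminus\{A_1,A_2\}|\le d$ and the odd-point union of $C\setminus\{A_1,A_2\}$ is contained in $A_1\cup A_2$. Put $$p=\begin{cases}2(1/1749)^{1/3}m^{-5/3}&(d=2)\\2(15/378131)^{1/4}m^{-7/4}&(d=3)\\2(30/10606681)^{1/5}m^{-9/5}&(d\ge4)\end{cases}$$ and $$\ell_d(m)=\begin{cases}\frac14\left(\frac1{1749}\right)^{1/3}m^{4/3}&(d=2)\\[2pt]\frac{4}{15^{3/4}\,378131^{1/4}}\,m^{5/4}&(d=3)\\[2pt]\frac53\left(\frac5{10606681}\right)^{1/5}6^{-4/5}\,m^{6/5}&(d\ge4).\end{cases}$$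 **Algorithm.** Fix an arbitrary order $T_1,T_2,\dots$ of the $\binom m3$ triples of $V$. For $i=1,\dots,\binom m3$ in turn, having decided about $T_1,\dots,T_{i-1}$, pick $T_i$ if and only if $\mathbb E(|\mathcal B|-|\mathcal X|)$ conditional on the earlier decisions and on picking $T_i$ is strictly larger than the same expectation conditional on the earlier decisions and on rejecting $T_i$. Here the triples after $T_i$ are regarded as being picked independently with probability $p$, $\mathcal B$ is the set of picked triples, and $\mathcal X$ is the set of $(d,2)$-forbidden configurations contained in $\mathcal B$. After all decisions, as long as the current set of triples contains a $(d,2)$-forbidden configuration $C$, discard an arbitrary triple of $C$. Output the remaining set of triples. **Theorem.** Let $d\ge2$ be fixed. 1. For every $m$ and every order of the triples, the algorithm has an output, and every possible output $\mathcal B$ (whatever triples are discarded) is an $(m,|\mathcal B|,d,2)$ X-code of constant weight $3$. 2. There is $m_0=m_0(d)$ such that for all $m\ge m_0$ every possible output satisfies $|\mathcal B|\ge\ell_d(m)$. 3. The algorithm can be implemented (for a suitable order of the triples and suitable choices of the discarded triples) by a deterministic program, depending only on $d$, that on input $m\ge1$ writes out an output of the algorithm and halts within $O\big(m^{9+\lceil(3d-1)/2\rceil}\big)$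 steps, where the implied constant depends only on $d$. The machine is a random access machine (real RAM) with an integer memory and a real memory and with indirect addressing, in which every instruction and every test costs one step: addition, truncated subtraction and comparison of natural numbers; conversion of a natural number to a real number; the four arithmetic operations, extraction of $k$-th roots, and comparison of real numbers. -/

import Mathlib

open Finset

noncomputable section

namespace XCode

/-! ### X-codes -/

/-- The Boolean disjunction on `𝔽₂`: it is `0` if both arguments are `0`, and `1` otherwise. -/
def vee (a b : ZMod 2) : ZMod 2 := if a = 0 ∧ b = 0 then 0 else 1

/-- The superimposed sum (coordinatewise disjunction) of the columns of `H` in the set `S`. -/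
def superimposedSum {ι κ : Type*} (H : Matrix ι κ (ZMod 2)) (S : Finset κ) : ι → ZMod 2 :=
  open Classical in fun i => if ∀ j ∈ S, H i j = 0 then 0 else 1

/-- The addition over `𝔽₂` of the columns of `H` in the set `D`. -/
def columnSum {ι κ : Type*} (H : Matrix ι κ (ZMod 2)) (D : Finset κ) : ι → ZMod 2 :=
  fun i => ∑ j ∈ D, H i j

/-- The column `a` is contained in the column `b`, that is, `a ∨ b = b`. -/
def Contained {ι : Type*} (a b : ι → ZMod 2) : Prop :=
  (fun i => vee (a i) (b i)) = b

/-- A binary matrix with `m` rows and `n` columns is an `(m, n, d, x)` X-code if the superimposed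
sum of any `x` columns does not contain the addition of any other up to `d` columns. -/
def IsXCode {ι κ : Type*} (d x : ℕ) (H : Matrix ι κ (ZMod 2)) : Prop :=
  ∀ S D : Finset κ, S.card = x → 1 ≤ D.card → D.card ≤ d → Disjoint S D →
    ¬ Contained (columnSum H D) (superimposedSum H S)

/-- Every column of `H` has exactly `w` ones. -/
def HasConstantWeight {ι κ : Type*} [Fintype ι] (w : ℕ) (H : Matrix ι κ (ZMod 2)) : Prop :=
  ∀ j, (univ.filter fun i => H i j = 1).card = w

/-- The point-by-block incidence matrix of the set system `(V, B)`;
it has `|V|` rows and `|B|` columns. -/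
def incidenceMatrix {V : Type*} [DecidableEq V] (B : Finset (Finset V)) :
    Matrix V {T // T ∈ B} (ZMod 2) :=
  fun v T => if v ∈ T.1 then 1 else 0

/-! ### Forbidden configurations -/

/-- The points that lie in an odd number of blocks of `D`. -/
def oddPointUnion {V : Type*} [Fintype V] [DecidableEq V] (D : Finset (Finset V)) : Finset V :=
  univ.filter fun v => Odd (D.filter fun T => v ∈ T).card

/-- A set `C` of triples is a `(d, x)`-forbidden configuration if it consists of `x` triples
together with between `1` and `d` other triples whose odd-point union is contained in the union
of the former `x` triples. -/
def IsForbidden {V : Type*} [Fintype V] [DecidableEq V] (d x : ℕ) (C : Finset (Finset V)) : Prop :=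
  (∀ T ∈ C, T.card = 3) ∧
    ∃ S ⊆ C, S.card = x ∧ 1 ≤ (C \ S).card ∧ (C \ S).card ≤ d ∧
      oddPointUnion (C \ S) ⊆ S.biUnion id

/-- The `(d, 2)`-forbidden configurations all of whose triples belong to `B`. -/
def realized {V : Type*} [Fintype V] [DecidableEq V] (d : ℕ) (B : Finset (Finset V)) :
    Finset (Finset (Finset V)) :=
  open Classical in univ.filter fun C => IsForbidden d 2 C ∧ C ⊆ B

/-! ### The derandomized algorithm -/

/-- The sampling probability `p`. -/
def samplingProb (m d : ℕ) : ℝ :=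
  if d = 2 then 2 * (1 / 1749 : ℝ) ^ (1 / 3 : ℝ) * (m : ℝ) ^ (-(5 / 3) : ℝ)
  else if d = 3 then 2 * (15 / 378131 : ℝ) ^ (1 / 4 : ℝ) * (m : ℝ) ^ (-(7 / 4) : ℝ)
  else 2 * (30 / 10606681 : ℝ) ^ (1 / 5 : ℝ) * (m : ℝ) ^ (-(9 / 5) : ℝ)

/-- The guaranteed number of codewords. -/
def codewordBound (m d : ℕ) : ℝ :=
  if d = 2 then 1 / 4 * (1 / 1749 : ℝ) ^ (1 / 3 : ℝ) * (m : ℝ) ^ (4 / 3 : ℝ)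
  else if d = 3 then
    4 / ((15 : ℝ) ^ (3 / 4 : ℝ) * (378131 : ℝ) ^ (1 / 4 : ℝ)) * (m : ℝ) ^ (5 / 4 : ℝ)
  else
    5 / 3 * (5 / 10606681 : ℝ) ^ (1 / 5 : ℝ) * (6 : ℝ) ^ (-(4 / 5) : ℝ) * (m : ℝ) ^ (6 / 5 : ℝ)

/-- The conditional expectation of `|𝓑| - |𝓧|` when the triples in `P` have been picked, the
triples in `R` are still undecided and each of them is picked independently with probability `p`,
and all other triples have been rejected. Here `𝓑` is the resulting set of triples and `𝓧` is
the set of forbidden configurations that it contains; the sum is over the subset `Q` of `R` that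
the random sampling picks. -/
def condExpectation {V : Type*} [Fintype V] [DecidableEq V] (d : ℕ) (p : ℝ)
    (P R : Finset (Finset V)) : ℝ :=
  ∑ Q ∈ R.powerset, p ^ Q.card * (1 - p) ^ (R \ Q).card *
    (((P ∪ Q).card : ℝ) - ((realized d (P ∪ Q)).card : ℝ))

/-- The list `L` is an ordering `T₁, T₂, …` of all the triples on `V`. -/
def IsTripleOrder {V : Type*} (L : List (Finset V)) : Prop :=
  L.Nodup ∧ ∀ T : Finset V, T ∈ L ↔ T.card = 3

/-- The selection loop: go through the list of undecided triples, and pick the next one if and only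
if picking it gives a strictly larger conditional expectation than rejecting it. The argument
`P` is the set of the triples picked so far. -/
def selectTriples {V : Type*} [Fintype V] [DecidableEq V] (d : ℕ) (p : ℝ) :
    Finset (Finset V) → List (Finset V) → Finset (Finset V)
  | P, [] => P
  | P, T :: L =>
      if condExpectation d p (insert T P) L.toFinset > condExpectation d p P L.toFinset then
        selectTriples d p (insert T P) L
      else
        selectTriples d p P L

/-- One round of the deletion loop: a triple of some forbidden configuration
contained in `B` is discarded. -/
def DeletionStep {V : Type*} [Fintype V] [DecidableEq V] (d : ℕ) (B B' : Finset (Finset V)) :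
    Prop :=
  ∃ C ∈ realized d B, ∃ T ∈ C, B' = B.erase T

/-- `B` is a possible output of the derandomized algorithm on the point set `{0, …, m - 1}` when it
uses the order `L` of the triples: it results from the selected set of triples by rounds of the
deletion loop, with arbitrary choices, and that loop has terminated. -/
def IsAlgorithmOutput (m d : ℕ) (L : List (Finset (Fin m))) (B : Finset (Finset (Fin m))) : Prop :=
  Relation.ReflTransGen (DeletionStep d) (selectTriples d (samplingProb m d) ∅ L) B ∧
    realized d B = ∅

/-! ### The machine model: a random access machine over the naturals and the reals

There are two memories, one whose cells hold natural numbers and one whose cells hold real numbers.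
An address is either a literal of the program or the content of a cell of the first memory
(indirect addressing). Natural numbers can be added, subtracted and compared; real numbers can be
added, subtracted, multiplied, divided and compared, and `k`-th roots can be extracted.
No real number can be turned into a natural number. Every instruction and every test costs one
step. -/

/-- The memory of the machine. -/
structure Memory where
  nat : ℕ → ℕ
  real : ℕ → ℝ

/-- The instructions. We write `N[i]` and `R[i]` for the cells of the two memories. -/
inductive Instr where
  /-- `N[i] := c` -/
  | constN (i c : ℕ)
  /-- `N[i] := N[j] + N[k]` -/
  | addN (i j k : ℕ)
  /-- `N[i] := max (N[j] - N[k]) 0` -/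
  | subN (i j k : ℕ)
  /-- `N[i] := N[N[j]]` -/
  | loadN (i j : ℕ)
  /-- `N[N[i]] := N[j]` -/
  | storeN (i j : ℕ)
  /-- `R[i] := N[j]` -/
  | castR (i j : ℕ)
  /-- `R[i] := R[j] + R[k]` -/
  | addR (i j k : ℕ)
  /-- `R[i] := R[j] - R[k]` -/
  | subR (i j k : ℕ)
  /-- `R[i] := R[j] * R[k]` -/
  | mulR (i j k : ℕ)
  /-- `R[i] := R[j] / R[k]` -/
  | divR (i j k : ℕ)
  /-- `R[i] :=` the `k`-th root of `max R[j] 0` -/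
  | rootR (i j k : ℕ)
  /-- `R[i] := R[N[j]]` -/
  | loadR (i j : ℕ)
  /-- `R[N[i]] := R[j]` -/
  | storeR (i j : ℕ)

/-- The effect of an instruction on the memory. -/
def Instr.apply (s : Memory) : Instr → Memory
  | constN i c => { s with nat := Function.update s.nat i c }
  | addN i j k => { s with nat := Function.update s.nat i (s.nat j + s.nat k) }
  | subN i j k => { s with nat := Function.update s.nat i (s.nat j - s.nat k) }
  | loadN i j => { s with nat := Function.update s.nat i (s.nat (s.nat j)) }
  | storeN i j => { s with nat := Function.update s.nat (s.nat i) (s.nat j) }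
  | castR i j => { s with real := Function.update s.real i (s.nat j : ℝ) }
  | addR i j k => { s with real := Function.update s.real i (s.real j + s.real k) }
  | subR i j k => { s with real := Function.update s.real i (s.real j - s.real k) }
  | mulR i j k => { s with real := Function.update s.real i (s.real j * s.real k) }
  | divR i j k => { s with real := Function.update s.real i (s.real j / s.real k) }
  | rootR i j k =>
      { s with real := Function.update s.real i ((max (s.real j) 0) ^ ((k : ℝ)⁻¹)) }
  | loadR i j => { s with real := Function.update s.real i (s.real (s.nat j)) }
  | storeR i j => { s with real := Function.update s.real (s.nat i) (s.real j) }

/-- The tests. -/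
inductive Test where
  /-- `N[i] < N[j]` -/
  | ltN (i j : ℕ)
  /-- `R[i] < R[j]` -/
  | ltR (i j : ℕ)

/-- The truth of a test. -/
def Test.Holds (s : Memory) : Test → Prop
  | ltN i j => s.nat i < s.nat j
  | ltR i j => s.real i < s.real j

/-- The programs. -/
inductive Program where
  | skip
  | instr (a : Instr)
  | seq (c₁ c₂ : Program)
  | branch (b : Test) (c₁ c₂ : Program)
  | loop (b : Test) (c : Program)

/-- One step of the machine. A configuration consists of the stack of the programs that remain to
be executed and of the memory; the machine has halted when the stack is empty. -/
def step : List Program × Memory → List Program × Memory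
  | ([], s) => ([], s)
  | (.skip :: K, s) => (K, s)
  | (.instr a :: K, s) => (K, a.apply s)
  | (.seq c₁ c₂ :: K, s) => (c₁ :: c₂ :: K, s)
  | (.branch b c₁ c₂ :: K, s) => open Classical in if b.Holds s then (c₁ :: K, s) else (c₂ :: K, s)
  | (.loop b c :: K, s) => open Classical in if b.Holds s then (c :: .loop b c :: K, s) else (K, s)

/-- Started in the memory `s`, the program `c` halts after at most `t` steps with the final memory
`s'`. -/
def HaltsWithin (c : Program) (s : Memory) (t : ℕ) (s' : Memory) : Prop :=
  step^[t] ([c], s) = ([], s')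

/-- The initial memory on the input `m`: `N[0] = m`, and all other cells are `0`. -/
def inputMemory (m : ℕ) : Memory where
  nat := Function.update (fun _ => 0) 0 m
  real := fun _ => 0

/-- The memory `s` presents the set `B` of triples on the point set `{0, …, m - 1}` as a list without
repetition: `N[0]` is the number of triples, `N[1]` is the address at which the list starts, and
each triple occupies three consecutive cells. -/
def Presents {m : ℕ} (s : Memory) (B : Finset (Finset (Fin m))) : Prop :=
  s.nat 0 = B.card ∧
    ∀ T : Finset (Fin m), T ∈ B ↔ ∃ j < s.nat 0,
      T.map Fin.valEmbedding =
        {s.nat (s.nat 1 + 3 * j), s.nat (s.nat 1 + 3 * j + 1), s.nat (s.nat 1 + 3 * j + 2)}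

end XCode

end

/-! Each configuration is a set of triples, so the probability that it survives is a product of
weights (`1` for picked, `p` for undecided, `0` for rejected triples). The conditional expectation
is therefore `|P| + p|R|` minus a sum of such products (`condExpectation_eq`), affine in every
single weight. Picking `T` is strictly better exactly when it raises the expected number of
forbidden configurations by less than one.

Correctness. If picking `T` completed a forbidden configuration, its product would jump from `0` to
`1` while no other product decreases, so the rise would be at least one and `T` would be rejected
(`realized_insert_eq_empty`). Hence the selected set contains no forbidden configuration, the
deletion loop never acts, and the output is unique for each order. A violation of the X-code
property is a forbidden configuration, so the output is an X-code.

Size. The value before a decision is a convex combination of the values after it, so the greedy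
choice never decreases it, and the output has at least `p * choose m 3` minus the expected number of
forbidden configurations under independent sampling. Configurations are grouped by isomorphism type
(`patterns`). One with `k + 2` triples covers at most `6 + 3k/2` points, and fewer for `k = 1, 2`.
With `p = α m^(-β)` and `γ = 3 - β`, a type with `j` points and `n` triples contributes order `m^(j
- βn)`, which reaches `m^γ` only for `(j, n) = (8, 4)`, `(10, 5)`, `(12, 6)` when `d = 2`, `d = 3`,
`d ≥ 4`. Counting these types crudely by all `n`-sets of triples on `j` points gives the constants;
the count is strict, and the slack absorbs the lower-order terms.

Running time. The patterns depend only on `d` and are written into the program. For each of the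
`O(m^3)` triples the sum of products is evaluated twice, by nested loops over at most `6 + ⌊3d/2⌋`
points, on a table of weights. Since `⌊3d/2⌋ = ⌈(3d-1)/2⌉`, this gives the exponent
(`exec_decideProgram`, `exec_mainLoop`). -/

noncomputable section

namespace XCode

/-! ### The conditional expectation as a multi-affine function of the weights -/

section Weights
variable {V : Type*} [DecidableEq V]

/-- The probability that a triple ends up being picked. -/
def weight (p : ℝ) (P R : Finset (Finset V)) (A : Finset V) : ℝ :=
  if A ∈ P then 1 else if A ∈ R then p else 0

/-- The weight of `T` occurs at most once in the product, which is thus affine in it; an undecided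
weight `p` interpolates between `1` (picked) and `0` (rejected). -/
lemma prod_weight_insert (p : ℝ) {P R : Finset (Finset V)} {T : Finset V} (hP : T ∉ P)
    (hR : T ∉ R) (C : Finset (Finset V)) :
    ∏ A ∈ C, weight p P (insert T R) A =
      p * ∏ A ∈ C, weight p (insert T P) R A + (1 - p) * ∏ A ∈ C, weight p P R A := by
  have hne : ∀ A ∈ C.erase T, weight p P (insert T R) A = weight p P R A ∧
      weight p (insert T P) R A = weight p P R A := by
    intro A hA
    have : A ≠ T := (mem_erase.1 hA).1
    simp [weight, this]
  by_cases hT : T ∈ C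
  · rw [← mul_prod_erase C _ hT, ← mul_prod_erase C _ hT, ← mul_prod_erase C _ hT,
      prod_congr rfl fun A hA => (hne A hA).1, prod_congr rfl fun A hA => (hne A hA).2]
    simp [weight, hP, hR]
  · rw [erase_eq_of_notMem hT] at hne
    rw [prod_congr rfl fun A hA => (hne A hA).1, prod_congr rfl fun A hA => (hne A hA).2]
    ring

lemma prod_weight_empty (p : ℝ) (P C : Finset (Finset V)) :
    ∏ A ∈ C, weight p P ∅ A = if C ⊆ P then 1 else 0 := by
  simp only [weight, notMem_empty, if_false]
  split_ifs with h
  · exact prod_eq_one fun A hA => if_pos (h hA)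
  · obtain ⟨A, hA, hAP⟩ := not_subset.1 h
    exact prod_eq_zero hA (if_neg hAP)

lemma weight_nonneg {p : ℝ} (hp : 0 ≤ p) (P R : Finset (Finset V)) (A : Finset V) :
    0 ≤ weight p P R A := by
  unfold weight; split_ifs <;> simp [hp]

lemma weight_mono_insert {p : ℝ} {P R : Finset (Finset V)} {T : Finset V} (hP : T ∉ P)
    (hR : T ∉ R) (A : Finset V) : weight p P R A ≤ weight p (insert T P) R A := by
  by_cases h : A = T
  · subst h; simp [weight, hP, hR]
  · simp [weight, h]

variable [Fintype V]

/-- The forbidden configurations on `V`. -/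
def forbidden (V : Type*) [Fintype V] [DecidableEq V] (d : ℕ) : Finset (Finset (Finset V)) :=
  open Classical in univ.filter fun C => IsForbidden d 2 C

lemma mem_forbidden {d : ℕ} {C : Finset (Finset V)} : C ∈ forbidden V d ↔ IsForbidden d 2 C := by
  simp [forbidden]

lemma mem_realized {d : ℕ} {B C : Finset (Finset V)} :
    C ∈ realized d B ↔ IsForbidden d 2 C ∧ C ⊆ B := by
  simp [realized]

/-- The expected number of forbidden configurations. -/
def expForbidden (d : ℕ) (p : ℝ) (P R : Finset (Finset V)) : ℝ :=
  ∑ C ∈ forbidden V d, ∏ A ∈ C, weight p P R A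

lemma expForbidden_insert (d : ℕ) (p : ℝ) {P R : Finset (Finset V)} {T : Finset V} (hP : T ∉ P)
    (hR : T ∉ R) :
    expForbidden d p P (insert T R) =
      p * expForbidden d p (insert T P) R + (1 - p) * expForbidden d p P R := by
  simp only [expForbidden, prod_weight_insert p hP hR, sum_add_distrib, mul_sum]

lemma expForbidden_empty (d : ℕ) (p : ℝ) (P : Finset (Finset V)) :
    expForbidden d p P ∅ = (realized d P).card := by
  simp only [expForbidden, prod_weight_empty, sum_boole]
  congr 2
  ext C
  simp [mem_realized, mem_forbidden]

lemma condExpectation_empty (d : ℕ) (p : ℝ) (P : Finset (Finset V)) :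
    condExpectation d p P ∅ = P.card - (realized d P).card := by
  simp [condExpectation]

lemma condExpectation_insert (d : ℕ) (p : ℝ) {P R : Finset (Finset V)} {T : Finset V}
    (hR : T ∉ R) :
    condExpectation d p P (insert T R) =
      p * condExpectation d p (insert T P) R + (1 - p) * condExpectation d p P R := by
  rw [condExpectation, sum_powerset_insert hR, add_comm, condExpectation, condExpectation, mul_sum,
    mul_sum]
  congr 1 <;> refine sum_congr rfl fun Q hQ => ?_
  · have hTQ : T ∉ Q := fun h => hR (mem_powerset.1 hQ h)
    rw [card_insert_of_notMem hTQ, insert_sdiff_insert, sdiff_insert_of_notMem hR, insert_union,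
      union_insert]
    ring
  · have hTQ : T ∉ Q := fun h => hR (mem_powerset.1 hQ h)
    rw [insert_sdiff_of_notMem _ hTQ, card_insert_of_notMem (fun h => hR (mem_sdiff.1 h).1)]
    ring

/-- The conditional expectation in closed form. -/
lemma condExpectation_eq (d : ℕ) (p : ℝ) (R : Finset (Finset V)) :
    ∀ P, Disjoint P R →
      condExpectation d p P R = P.card + p * R.card - expForbidden d p P R := by
  induction R using Finset.induction_on with
  | empty => intro P _; simp [condExpectation_empty, expForbidden_empty]
  | insert T R hT ih =>
    intro P hP
    rw [disjoint_insert_right] at hP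
    -- Both sides obey the same recursion when the last undecided triple is decided.
    rw [condExpectation_insert d p hT, expForbidden_insert d p hP.1 hT, ih P hP.2,
      ih (insert T P) (disjoint_insert_left.2 ⟨hT, hP.2⟩), card_insert_of_notMem hT,
      card_insert_of_notMem hP.1]
    push_cast
    ring

/-- Picking the triple is strictly better if and only if this increases the expected number of
forbidden configurations by less than one. -/
lemma condExpectation_gt_iff (d : ℕ) (p : ℝ) {P R : Finset (Finset V)} {T : Finset V} (hP : T ∉ P)
    (hR : T ∉ R) (h : Disjoint P R) :
    condExpectation d p (insert T P) R > condExpectation d p P R ↔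
      expForbidden d p (insert T P) R < expForbidden d p P R + 1 := by
  rw [condExpectation_eq d p R _ h, condExpectation_eq d p R _ (disjoint_insert_left.2 ⟨hR, h⟩),
    card_insert_of_notMem hP]
  push_cast
  constructor <;> intro <;> linarith

/-- A newly completed configuration contains `T`, so its product rises from `0` to `1`. All other
products are monotone in the weights, so the total rises by at least one, against `hlt`. Only `0 ≤
p` matters here; `p ≤ 1` is not needed for correctness. -/
lemma realized_insert_eq_empty {d : ℕ} {p : ℝ} (hp : 0 ≤ p) {P R : Finset (Finset V)}
    {T : Finset V} (hP : T ∉ P) (hR : T ∉ R) (hreal : realized d P = ∅)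
    (hlt : expForbidden d p (insert T P) R < expForbidden d p P R + 1) :
    realized d (insert T P) = ∅ := by
  by_contra hne
  obtain ⟨C, hC⟩ := nonempty_iff_ne_empty.2 hne
  rw [mem_realized] at hC
  have hTC : T ∈ C := by
    by_contra hTC
    have : C ∈ realized d P :=
      mem_realized.2 ⟨hC.1, fun A hA => (mem_insert.1 (hC.2 hA)).resolve_left
        fun h => hTC (h ▸ hA)⟩
    simp [hreal] at this
  have hCf : C ∈ forbidden V d := mem_forbidden.2 hC.1
  have h1 : ∏ A ∈ C, weight p (insert T P) R A = 1 :=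
    prod_eq_one fun A hA => by simp only [weight, if_pos (hC.2 hA)]
  have h0 : ∏ A ∈ C, weight p P R A = 0 :=
    prod_eq_zero hTC (by simp [weight, hP, hR])
  have hrest : ∑ C' ∈ (forbidden V d).erase C, ∏ A ∈ C', weight p P R A ≤
      ∑ C' ∈ (forbidden V d).erase C, ∏ A ∈ C', weight p (insert T P) R A :=
    sum_le_sum fun C' _ => prod_le_prod (fun A _ => weight_nonneg hp P R A)
      fun A _ => weight_mono_insert hP hR A
  rw [expForbidden, expForbidden, ← add_sum_erase _ _ hCf, ← add_sum_erase _ _ hCf, h1, h0] at hlt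
  linarith

/-! ### The selection loop -/

lemma selectTriples_subset (d : ℕ) (p : ℝ) (L : List (Finset V)) :
    ∀ P, selectTriples d p P L ⊆ P ∪ L.toFinset := by
  induction L with
  | nil => intro P; simp [selectTriples]
  | cons T L ih =>
    intro P
    rw [selectTriples]
    split_ifs
    · refine (ih _).trans fun A hA => ?_
      simp only [mem_union, mem_insert, List.mem_toFinset, List.mem_cons] at hA ⊢
      tauto
    · refine (ih _).trans fun A hA => ?_
      simp only [mem_union, List.mem_toFinset, List.mem_cons] at hA ⊢
      tauto

lemma realized_selectTriples {d : ℕ} {p : ℝ} (hp : 0 ≤ p) (L : List (Finset V)) :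
    ∀ P, L.Nodup → Disjoint P L.toFinset → realized d P = ∅ →
      realized d (selectTriples d p P L) = ∅ := by
  induction L with
  | nil => intro P _ _ h; simpa [selectTriples] using h
  | cons T L ih =>
    intro P hL hdisj hP
    rw [List.nodup_cons] at hL
    rw [List.toFinset_cons, disjoint_insert_right] at hdisj
    have hTL : T ∉ L.toFinset := by simpa using hL.1
    rw [selectTriples]
    split_ifs with h
    · refine ih _ hL.2 (disjoint_insert_left.2 ⟨hTL, hdisj.2⟩) ?_
      exact realized_insert_eq_empty hp hdisj.1 hTL hP
        ((condExpectation_gt_iff d p hdisj.1 hTL hdisj.2).1 h)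
    · exact ih _ hL.2 hdisj.2 hP

/-- The method of conditional expectations: with `T` undecided the value is a convex combination of
the two decided values, and the loop takes the larger. This is where `p ≤ 1` enters. -/
lemma condExpectation_le_selectTriples {d : ℕ} {p : ℝ} (hp : 0 ≤ p) (hp1 : p ≤ 1)
    (L : List (Finset V)) :
    ∀ P, L.Nodup → condExpectation d p P L.toFinset ≤
      condExpectation d p (selectTriples d p P L) ∅ := by
  induction L with
  | nil => intro P _; simp [selectTriples]
  | cons T L ih =>
    intro P hL
    rw [List.nodup_cons] at hL
    rw [selectTriples, List.toFinset_cons, condExpectation_insert d p (by simpa using hL.1)]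
    split_ifs with h
    · refine le_trans ?_ (ih _ hL.2)
      nlinarith
    · refine le_trans ?_ (ih _ hL.2)
      nlinarith

end Weights

/-! ### Uniqueness of the output -/

lemma samplingProb_nonneg (m d : ℕ) : 0 ≤ samplingProb m d := by
  unfold samplingProb; split_ifs <;> positivity

lemma realized_empty {V : Type*} [Fintype V] [DecidableEq V] (d : ℕ) :
    realized d (∅ : Finset (Finset V)) = ∅ := by
  ext C
  simp only [mem_realized, notMem_empty, iff_false, not_and]
  rintro ⟨-, S, hS, hcard, -⟩ hC
  rw [subset_empty.1 (hS.trans hC)] at hcard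
  simp at hcard

/-- The algorithm has exactly one output, since the deletion loop has nothing to do. -/
lemma isAlgorithmOutput_iff {m d : ℕ} {L : List (Finset (Fin m))} (hL : IsTripleOrder L)
    (B : Finset (Finset (Fin m))) :
    IsAlgorithmOutput m d L B ↔ B = selectTriples d (samplingProb m d) ∅ L := by
  have h0 : realized d (selectTriples d (samplingProb m d) ∅ L) = ∅ :=
    realized_selectTriples (samplingProb_nonneg m d) L ∅ hL.1 (disjoint_empty_left _)
      (realized_empty d)
  constructor
  · rintro ⟨h, -⟩
    rcases Relation.ReflTransGen.cases_head h with h | ⟨B', ⟨C, hC, -⟩, -⟩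
    · exact h.symm
    · simp [h0] at hC
  · rintro rfl
    exact ⟨.refl, h0⟩

/-! ### Forbidden configurations and X-codes -/

lemma hasConstantWeight_incidenceMatrix {V : Type*} [Fintype V] [DecidableEq V]
    {B : Finset (Finset V)} {w : ℕ} (h : ∀ T ∈ B, T.card = w) :
    HasConstantWeight w (incidenceMatrix B) := by
  rintro ⟨T, hT⟩
  have : (univ.filter fun v => incidenceMatrix B v ⟨T, hT⟩ = 1) = T := by
    ext v; simp [incidenceMatrix]
  rw [this, h T hT]

lemma columnSum_incidenceMatrix {V : Type*} [Fintype V] [DecidableEq V] {B : Finset (Finset V)}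
    (D : Finset {T // T ∈ B}) (v : V) :
    columnSum (incidenceMatrix B) D v = 0 ↔
      v ∉ oddPointUnion (D.map (Function.Embedding.subtype _)) := by
  have : ((D.map (Function.Embedding.subtype (· ∈ B))).filter fun T => v ∈ T).card =
      (D.filter fun T => v ∈ T.1).card := by
    rw [filter_map, card_map]; rfl
  simp only [columnSum, incidenceMatrix, sum_boole, oddPointUnion, mem_filter, mem_univ, true_and,
    this, Nat.not_odd_iff_even, ZMod.natCast_eq_zero_iff_even]

/-- If `S` and `D` violate the X-code property, their union is forbidden: disjointness recovers `D`
as the complement of `S`, a nonzero entry of the sum over `𝔽₂` marks a point of odd degree, and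
containment says that this point lies in a triple of `S`. -/
lemma isXCode_of_realized_eq_empty {V : Type*} [Fintype V] [DecidableEq V] {d : ℕ}
    {B : Finset (Finset V)} (h3 : ∀ T ∈ B, T.card = 3) (h : realized d B = ∅) :
    IsXCode d 2 (incidenceMatrix B) := by
  intro S D hS hD1 hDd hdisj hcont
  set e := Function.Embedding.subtype (· ∈ B)
  have hsub : ∀ E : Finset {T // T ∈ B}, E.map e ⊆ B := by
    intro E T hT
    obtain ⟨T', -, rfl⟩ := mem_map.1 hT
    exact T'.2
  have hsd : (S.map e ∪ D.map e) \ S.map e = D.map e := by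
    rw [union_sdiff_left, _root_.sdiff_eq_self_iff_disjoint, disjoint_map]
    exact hdisj
  have hmem : S.map e ∪ D.map e ∈ realized d B := by
    refine mem_realized.2 ⟨⟨fun T hT => h3 T ?_, S.map e, subset_union_left, by simpa, ?_⟩, ?_⟩
    · rcases mem_union.1 hT with h | h <;> exact hsub _ h
    · rw [hsd, card_map]
      refine ⟨hD1, hDd, fun v hv => ?_⟩
      have hne : columnSum (incidenceMatrix B) D v ≠ 0 := fun h0 =>
        (columnSum_incidenceMatrix D v).1 h0 hv
      have hv' := congrFun hcont v
      simp only [vee, hne, false_and, if_false, superimposedSum] at hv'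
      split_ifs at hv' with h0
      · simp at hv'
      · push Not at h0
        obtain ⟨T, hT, hTv⟩ := h0
        have : v ∈ T.1 := by
          by_contra hn
          simp [incidenceMatrix, hn] at hTv
        exact mem_biUnion.2 ⟨T.1, mem_map.2 ⟨T, hT, rfl⟩, this⟩
    · exact union_subset (hsub _) (hsub _)
  simp [h] at hmem

theorem algorithm_correct (m d : ℕ) (L : List (Finset (Fin m))) (hL : IsTripleOrder L) :
    (∃ B, IsAlgorithmOutput m d L B) ∧
      ∀ B, IsAlgorithmOutput m d L B →
        IsXCode d 2 (incidenceMatrix B) ∧ HasConstantWeight 3 (incidenceMatrix B) := by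
  refine ⟨⟨_, (isAlgorithmOutput_iff hL _).2 rfl⟩, fun B hB => ?_⟩
  have h3 : ∀ T ∈ B, T.card = 3 := by
    intro T hT
    rw [(isAlgorithmOutput_iff hL B).1 hB] at hT
    have := selectTriples_subset d _ L ∅ hT
    rw [empty_union, List.mem_toFinset] at this
    exact (hL.2 T).1 this
  exact ⟨isXCode_of_realized_eq_empty h3 hB.2, hasConstantWeight_incidenceMatrix h3⟩

/-! ### Forbidden configurations up to isomorphism -/

section Patterns
variable {α V : Type*} [Fintype α] [DecidableEq α] [Fintype V] [DecidableEq V]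

/-- The image of a family of sets under an injection of the points. -/
def mapFamily (e : α ↪ V) : Finset (Finset α) ↪ Finset (Finset V) :=
  (mapEmbedding (mapEmbedding e).toEmbedding).toEmbedding

omit [Fintype α] [DecidableEq α] [Fintype V] [DecidableEq V] in
lemma mapFamily_apply (e : α ↪ V) (Q : Finset (Finset α)) :
    mapFamily e Q = Q.map (mapEmbedding e).toEmbedding := rfl

omit [Fintype α] [Fintype V] in
lemma biUnion_mapFamily (e : α ↪ V) (Q : Finset (Finset α)) :
    (mapFamily e Q).biUnion id = (Q.biUnion id).map e := by
  ext v
  simp only [mapFamily_apply, mem_biUnion, mem_map, id]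
  constructor
  · rintro ⟨_, ⟨A, hA, rfl⟩, hv⟩
    obtain ⟨a, ha, rfl⟩ := mem_map.1 hv
    exact ⟨a, ⟨A, hA, ha⟩, rfl⟩
  · rintro ⟨a, ⟨A, hA, ha⟩, rfl⟩
    exact ⟨_, ⟨A, hA, rfl⟩, mem_map_of_mem _ ha⟩

lemma oddPointUnion_mapFamily (e : α ↪ V) (D : Finset (Finset α)) :
    oddPointUnion (mapFamily e D) = (oddPointUnion D).map e := by
  have hcard : ∀ v, ((mapFamily e D).filter fun T => v ∈ T).card =
      (D.filter fun T => v ∈ T.map e).card := by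
    intro v
    rw [mapFamily_apply, filter_map, card_map]; rfl
  ext v
  simp only [oddPointUnion, mem_filter, mem_univ, true_and, hcard, mem_map]
  constructor
  · intro h
    -- A point of odd degree lies in at least one block, hence in the image of `e`.
    obtain ⟨T, hT⟩ := card_pos.1 h.pos
    obtain ⟨a, -, rfl⟩ := (mem_filter.1 hT).2
    exact ⟨a, by simpa using h, rfl⟩
  · rintro ⟨a, h, rfl⟩
    simpa using h

lemma isForbidden_mapFamily (d x : ℕ) (e : α ↪ V) (Q : Finset (Finset α)) :
    IsForbidden d x (mapFamily e Q) ↔ IsForbidden d x Q := by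
  have hsd : ∀ S, mapFamily e Q \ mapFamily e S = mapFamily e (Q \ S) := fun S => by
    simp only [mapFamily_apply, Finset.map_sdiff]
  have hcard : ∀ S : Finset (Finset α), (mapFamily e S).card = S.card := fun S => by
    rw [mapFamily_apply, card_map]
  unfold IsForbidden
  refine and_congr (by simp [mapFamily_apply]) ⟨?_, ?_⟩
  · rintro ⟨S, hS, h⟩
    obtain ⟨S, hS', rfl⟩ := subset_map_iff.1 hS
    change (mapFamily e S).card = x ∧ 1 ≤ (mapFamily e Q \ mapFamily e S).card ∧
      (mapFamily e Q \ mapFamily e S).card ≤ d ∧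
      oddPointUnion (mapFamily e Q \ mapFamily e S) ⊆ (mapFamily e S).biUnion id at h
    rw [hsd, hcard, hcard, oddPointUnion_mapFamily, biUnion_mapFamily, map_subset_map] at h
    exact ⟨S, hS', h⟩
  · rintro ⟨S, hS, h⟩
    refine ⟨mapFamily e S, map_subset_map.2 hS, ?_⟩
    rwa [hsd, hcard, hcard, oddPointUnion_mapFamily, biUnion_mapFamily, map_subset_map]

/-- The forbidden configurations on `j` points that cover all these points. -/
def patterns (d j : ℕ) : Finset (Finset (Finset (Fin j))) :=
  (forbidden (Fin j) d).filter fun Q => Q.biUnion id = univ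

lemma mem_patterns {d j : ℕ} {Q : Finset (Finset (Fin j))} :
    Q ∈ patterns d j ↔ IsForbidden d 2 Q ∧ Q.biUnion id = univ := by
  rw [patterns, mem_filter, mem_forbidden]

/-- The forbidden configurations with point set `S` are the images of the patterns. -/
lemma sum_forbidden_filter_eq (d j : ℕ) (e : Fin j ↪ V) (f : Finset V → ℝ) :
    ∑ C ∈ (forbidden V d).filter (fun C => C.biUnion id = univ.map e), ∏ A ∈ C, f A =
      ∑ Q ∈ patterns d j, ∏ A ∈ Q, f (A.map e) := by
  have : (forbidden V d).filter (fun C => C.biUnion id = univ.map e) =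
      (patterns d j).map (mapFamily e) := by
    ext C
    simp only [mem_filter, mem_forbidden, mem_map, mem_patterns]
    constructor
    · rintro ⟨hC, hU⟩
      have hsub : C ⊆ (univ : Finset (Finset (Fin j))).map (mapEmbedding e).toEmbedding := by
        intro A hA
        have : A ⊆ univ.map e := hU ▸ subset_biUnion_of_mem id hA
        obtain ⟨A', -, rfl⟩ := subset_map_iff.1 this
        exact mem_map_of_mem _ (mem_univ _)
      obtain ⟨Q, -, rfl⟩ := subset_map_iff.1 hsub
      change IsForbidden d 2 (mapFamily e Q) at hC
      change (mapFamily e Q).biUnion id = _ at hU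
      rw [isForbidden_mapFamily] at hC
      rw [biUnion_mapFamily, map_inj] at hU
      exact ⟨Q, ⟨hC, hU⟩, rfl⟩
    · rintro ⟨Q, ⟨hQ, hU⟩, rfl⟩
      rw [isForbidden_mapFamily, biUnion_mapFamily, hU]
      exact ⟨hQ, rfl⟩
  rw [this, sum_map]
  refine sum_congr rfl fun Q _ => ?_
  rw [mapFamily_apply, prod_map]
  rfl

/-- A forbidden configuration covers few points. -/
lemma IsForbidden.card_le {d : ℕ} {C : Finset (Finset V)} (h : IsForbidden d 2 C) :
    ∃ k u, 1 ≤ k ∧ k ≤ d ∧ C.card = k + 2 ∧ (C.biUnion id).card ≤ 6 + u ∧ u * 2 ≤ 3 * k ∧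
      (k = 1 → u = 0) ∧ (k = 2 → u ≤ 2) := by
  obtain ⟨h3, S, hSC, hS2, h1, hd, hodd⟩ := h
  set D := C \ S with hD
  set U := D.biUnion id \ S.biUnion id with hU
  have hD3 : ∀ T ∈ D, T.card = 3 := fun T hT => h3 T (mem_sdiff.1 hT).1
  -- A point of `D` outside the two triples of `S` cannot have odd degree, and its degree is
  -- positive.
  have hdeg : ∀ v ∈ U, 2 ≤ (D.filter fun T => v ∈ T).card := by
    intro v hv
    obtain ⟨hv1, hv2⟩ := mem_sdiff.1 hv
    obtain ⟨T, hT, hvT⟩ := mem_biUnion.1 hv1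
    have hpos : 0 < (D.filter fun T => v ∈ T).card := card_pos.2 ⟨T, mem_filter.2 ⟨hT, hvT⟩⟩
    have heven : ¬ Odd (D.filter fun T => v ∈ T).card := fun ho =>
      hv2 (hodd (mem_filter.2 ⟨mem_univ _, ho⟩))
    rw [Nat.not_odd_iff_even] at heven
    obtain ⟨r, hr⟩ := heven
    lia
  refine ⟨D.card, U.card, h1, hd, ?_, ?_, ?_, ?_, ?_⟩
  · rw [hD, card_sdiff_of_subset hSC, hS2]
    have := card_le_card hSC
    lia
  · have hsub : C.biUnion id ⊆ S.biUnion id ∪ U := by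
      intro v hv
      obtain ⟨T, hT, hvT⟩ := mem_biUnion.1 hv
      by_cases hvS : v ∈ S.biUnion id
      · exact mem_union_left _ hvS
      · refine mem_union_right _ (mem_sdiff.2 ⟨mem_biUnion.2 ⟨T, mem_sdiff.2 ⟨hT, fun hTS => ?_⟩,
          hvT⟩, hvS⟩)
        exact hvS (mem_biUnion.2 ⟨T, hTS, hvT⟩)
    have h6 : (S.biUnion id).card ≤ 2 * 3 := hS2 ▸ card_biUnion_le_card_mul S id 3
      fun T hT => (h3 T (hSC hT)).le
    have := card_le_card hsub
    have := card_union_le (S.biUnion id) U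
    lia
  -- Double counting of incidences between `U` and `D`: at least two blocks per point, at most three
  -- points per block.
  · have hle := le_sum_card_inter hdeg
    have : ∑ T ∈ D, (U ∩ T).card ≤ ∑ T ∈ D, 3 :=
      sum_le_sum fun T hT => (card_le_card inter_subset_right).trans (hD3 T hT).le
    rw [sum_const, smul_eq_mul] at this
    lia
  · intro hk
    rw [card_eq_zero, eq_empty_iff_forall_notMem]
    intro v hv
    have := hdeg v hv
    have := card_filter_le D fun T => v ∈ T
    lia
  -- With two blocks, every point of `U` lies in both. Three such points would make both blocks
  -- equal to `U`.
  · intro hk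
    by_contra! hu
    have hUT : ∀ T ∈ D, U = T := by
      intro T hT
      refine eq_of_subset_of_card_le (fun v hv => ?_) (by rw [hD3 T hT]; exact hu)
      have : D.filter (fun T => v ∈ T) = D :=
        eq_of_subset_of_card_le (filter_subset _ _) (hk ▸ hdeg v hv)
      rw [← this] at hT
      exact (mem_filter.1 hT).2
    have : D.card ≤ 1 := card_le_one.2 fun A hA B hB => (hUT A hA).symm.trans (hUT B hB)
    lia

lemma IsForbidden.card_biUnion_lt {d : ℕ} {C : Finset (Finset V)} (h : IsForbidden d 2 C) :
    (C.biUnion id).card < 7 + 3 * d / 2 := by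
  obtain ⟨k, u, -, hkd, -, hle, hu, -, -⟩ := h.card_le
  lia

/-- Grouping by covered point set serves twice: by symmetry it gives the count under uniform
weights, and it is the order in which the program's nested loops accumulate the sum. -/
lemma sum_forbidden_eq (d : ℕ) (f : Finset V → ℝ) :
    ∑ C ∈ forbidden V d, ∏ A ∈ C, f A =
      ∑ j ∈ range (7 + 3 * d / 2), ∑ S ∈ powersetCard j univ,
        ∑ C ∈ (forbidden V d).filter (fun C => C.biUnion id = S), ∏ A ∈ C, f A := by
  rw [← sum_fiberwise_of_maps_to (t := univ.filter fun S : Finset V => S.card < 7 + 3 * d / 2)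
    (g := fun C => C.biUnion id)
    (fun C hC => mem_filter.2 ⟨mem_univ _, (mem_forbidden.1 hC).card_biUnion_lt⟩),
    ← sum_fiberwise_of_maps_to (t := range (7 + 3 * d / 2)) (g := card)
    (fun S hS => mem_range.2 (mem_filter.1 hS).2)]
  refine sum_congr rfl fun j hj => sum_congr ?_ fun _ _ => rfl
  ext S
  have := mem_range.1 hj
  simp only [mem_filter, mem_univ, true_and, mem_powersetCard_univ]
  lia

/-- With nothing decided all triples weigh `p`, so every `j`-set of points contributes the same sum
over patterns. -/
lemma expForbidden_univ (d m : ℕ) (p : ℝ) :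
    expForbidden d p ∅ (powersetCard 3 (univ : Finset (Fin m))) =
      ∑ j ∈ range (7 + 3 * d / 2), ∑ Q ∈ patterns d j, m.choose j * p ^ Q.card := by
  have h1 : expForbidden d p ∅ (powersetCard 3 (univ : Finset (Fin m))) =
      ∑ C ∈ forbidden (Fin m) d, ∏ A ∈ C, p := by
    refine sum_congr rfl fun C hC => prod_congr rfl fun A hA => ?_
    have := (mem_forbidden.1 hC).1 A hA
    simp [weight, mem_powersetCard, this]
  rw [h1, sum_forbidden_eq d fun _ => p]
  refine sum_congr rfl fun j _ => ?_
  have h2 : ∀ S ∈ powersetCard j (univ : Finset (Fin m)),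
      ∑ C ∈ (forbidden (Fin m) d).filter (fun C => C.biUnion id = S), ∏ A ∈ C, p =
        ∑ Q ∈ patterns d j, p ^ Q.card := by
    intro S hS
    have hS := (mem_powersetCard.1 hS).2
    have := sum_forbidden_filter_eq d j (S.orderEmbOfFin hS).toEmbedding fun _ => p
    simpa using this
  rw [sum_congr rfl h2, sum_const, card_powersetCard, card_univ, Fintype.card_fin, nsmul_eq_mul,
    mul_sum]

/-- Patterns are among the `n`-sets of triples, but an `n`-set of triples avoiding the point `0`,
which exists because `n ≤ j.choose 3`, covers too little to be one. The strictness is what leaves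
room for lower-order terms. -/
lemma card_patterns_filter_lt (d : ℕ) {j n : ℕ} (hn : n ≤ j.choose 3) :
    ((patterns d (j + 1)).filter fun Q => Q.card = n).card < ((j + 1).choose 3).choose n := by
  have hcard : (powersetCard n (powersetCard 3 (univ : Finset (Fin (j + 1))))).card =
      ((j + 1).choose 3).choose n := by simp
  rw [← hcard]
  refine card_lt_card (ssubset_iff_of_subset (fun Q hQ => ?_) |>.2 ?_)
  · rw [mem_filter, mem_patterns] at hQ
    exact mem_powersetCard.2 ⟨fun A hA => mem_powersetCard.2 ⟨subset_univ _, hQ.1.1.1 A hA⟩, hQ.2⟩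
  · have : n ≤ (powersetCard 3 (univ.erase (0 : Fin (j + 1)))).card := by
      simpa [card_powersetCard] using hn
    obtain ⟨Q, hQ, hQn⟩ := exists_subset_card_eq this
    refine ⟨Q, mem_powersetCard.2 ⟨hQ.trans (powersetCard_mono (erase_subset _ _)), hQn⟩, ?_⟩
    rw [mem_filter, mem_patterns]
    rintro ⟨⟨-, hU⟩, -⟩
    obtain ⟨A, hA, h0⟩ := mem_biUnion.1 (hU ▸ mem_univ (0 : Fin (j + 1)))
    exact notMem_erase _ _ ((mem_powersetCard.1 (hQ hA)).1 h0)

end Patterns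

/-! ### The number of codewords -/

-- Since `choose m j ~ m^j / j!`, the quotient behaves like `m^(j - βn - γ)` up to a constant; the
-- exponent is nonpositive by `h`, and the limit survives only when it is zero.
open Filter Topology in
lemma tendsto_choose_mul_pow (j n : ℕ) (α β γ : ℝ) (h : (j : ℝ) ≤ β * n + γ) :
    Tendsto (fun m : ℕ => (m.choose j : ℝ) * (α * (m : ℝ) ^ (-β)) ^ n / (m : ℝ) ^ γ) atTop
      (𝓝 (if (j : ℝ) = β * n + γ then α ^ n / j.factorial else 0)) := by
  have h1 : Tendsto (fun m : ℕ => (m.choose j : ℝ) / (m : ℝ) ^ j) atTop (𝓝 (1 / j.factorial)) := by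
    have h2 := isEquivalent_choose j
    rw [Asymptotics.isEquivalent_iff_tendsto_one] at h2
    · refine (h2.mul_const (1 / (j.factorial : ℝ))).congr' ?_ |>.trans (by simp)
      filter_upwards [eventually_gt_atTop 0] with m hm
      have : (j.factorial : ℝ) ≠ 0 := by positivity
      have : (m : ℝ) ≠ 0 := by positivity
      simp only [Pi.div_apply]
      field_simp
    · filter_upwards [eventually_gt_atTop 0] with m hm
      positivity
  have h2 : Tendsto (fun m : ℕ => α ^ n * (m : ℝ) ^ ((j : ℝ) - β * n - γ)) atTop
      (𝓝 (if (j : ℝ) = β * n + γ then α ^ n else 0)) := by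
    split_ifs with heq
    · have : (j : ℝ) - β * n - γ = 0 := by linarith
      simp [this]
    · have hlt : 0 < -((j : ℝ) - β * n - γ) := by
        have := lt_of_le_of_ne h heq
        linarith
      have := ((tendsto_rpow_neg_atTop hlt).comp tendsto_natCast_atTop_atTop).const_mul (α ^ n)
      simpa using this
  have h3 := h1.mul h2
  have hlim : 1 / (j.factorial : ℝ) * (if (j : ℝ) = β * n + γ then α ^ n else 0) =
      if (j : ℝ) = β * n + γ then α ^ n / j.factorial else 0 := by
    split_ifs <;> ring
  rw [hlim] at h3
  refine h3.congr' ?_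
  filter_upwards [eventually_gt_atTop 0] with m hm
  have hm : (0 : ℝ) < m := by positivity
  rw [Real.rpow_sub hm, Real.rpow_sub hm, mul_pow, ← Real.rpow_natCast ((m : ℝ) ^ (-β)),
    ← Real.rpow_mul hm.le, Real.rpow_natCast, neg_mul, Real.rpow_neg hm.le]
  field_simp

-- After division by `m^γ`, only the patterns with `j + 1` points and `n` triples survive in the
-- limit, by `hpat`.
open Filter Topology in
lemma eventually_le_expectation {d j n : ℕ} {α β γ l : ℝ} (hα : 0 < α) (h3 : 3 = β + γ)
    (hj : ((j + 1 : ℕ) : ℝ) = β * n + γ) (hn : n ≤ j.choose 3) (hd : j + 1 < 7 + 3 * d / 2)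
    (hpat : ∀ i, ∀ Q ∈ patterns d i, i = j + 1 ∧ Q.card = n ∨ (i : ℝ) < β * Q.card + γ)
    (hl : l = α / 6 - ((j + 1).choose 3).choose n * α ^ n / (j + 1).factorial) :
    ∀ᶠ m : ℕ in atTop, l * (m : ℝ) ^ γ ≤ α * (m : ℝ) ^ (-β) * m.choose 3 -
      ∑ i ∈ range (7 + 3 * d / 2), ∑ Q ∈ patterns d i,
        m.choose i * (α * (m : ℝ) ^ (-β)) ^ Q.card := by
  have hle : ∀ i, ∀ Q ∈ patterns d i, (i : ℝ) ≤ β * Q.card + γ := by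
    intro i Q hQ
    rcases hpat i Q hQ with ⟨rfl, h⟩ | h
    · rw [h]; exact hj.le
    · exact h.le
  have ht1 := tendsto_choose_mul_pow 3 1 α β γ (by push_cast; linarith)
  have ht2 : Tendsto (fun m : ℕ => ∑ i ∈ range (7 + 3 * d / 2), ∑ Q ∈ patterns d i,
      (m.choose i : ℝ) * (α * (m : ℝ) ^ (-β)) ^ Q.card / (m : ℝ) ^ γ) atTop
      (𝓝 (∑ i ∈ range (7 + 3 * d / 2), ∑ Q ∈ patterns d i,
        if (i : ℝ) = β * Q.card + γ then α ^ Q.card / i.factorial else 0)) :=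
    tendsto_finsetSum _ fun i _ => tendsto_finsetSum _ fun Q hQ =>
      tendsto_choose_mul_pow i Q.card α β γ (hle i Q hQ)
  have hlim : ∑ i ∈ range (7 + 3 * d / 2), ∑ Q ∈ patterns d i,
        (if (i : ℝ) = β * Q.card + γ then α ^ Q.card / i.factorial else 0) =
      ((patterns d (j + 1)).filter fun Q => Q.card = n).card * (α ^ n / (j + 1).factorial) := by
    rw [sum_eq_single_of_mem (j + 1) (mem_range.2 hd), ← sum_filter]
    · rw [← nsmul_eq_mul, ← sum_const]
      refine sum_congr (filter_congr fun Q hQ => ?_) fun Q hQ => by rw [(mem_filter.1 hQ).2]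
      rcases hpat _ Q hQ with ⟨-, h⟩ | h
      · simp only [h, hj]
      · refine iff_of_false h.ne fun hQn => ?_
        rw [hQn, hj] at h
        exact lt_irrefl _ h
    · refine fun i _ hi => sum_eq_zero fun Q hQ => if_neg ?_
      rcases hpat _ Q hQ with ⟨h, -⟩ | h
      · exact absurd h hi
      · exact h.ne
  rw [hlim] at ht2
  have ht := ht1.sub ht2
  rw [if_pos (by push_cast; linarith)] at ht
  -- Here `l` is formed with the over-count of the extremal patterns, so it lies strictly below the
  -- limit.
  have hlt : l < α ^ 1 / (Nat.factorial 3 : ℝ) -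
      ((patterns d (j + 1)).filter fun Q => Q.card = n).card * (α ^ n / (j + 1).factorial) := by
    have h1 : (((patterns d (j + 1)).filter fun Q => Q.card = n).card : ℝ) <
        ((j + 1).choose 3).choose n := by exact_mod_cast card_patterns_filter_lt d hn
    have h2 : 0 < α ^ n / (j + 1).factorial := by positivity
    have h3 := mul_lt_mul_of_pos_right h1 h2
    rw [hl, mul_div_assoc]
    norm_num [Nat.factorial] at h3 ⊢
    linarith
  filter_upwards [ht.eventually_const_lt hlt, eventually_gt_atTop 0] with m hm hm0
  have hpos : 0 < (m : ℝ) ^ γ := by positivity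
  simp only [← sum_div, ← sub_div, pow_one] at hm
  rw [lt_div_iff₀ hpos, mul_comm (m.choose 3 : ℝ)] at hm
  exact hm.le

open Filter Topology in
lemma eventually_codewordBound_le {d j n : ℕ} {α β γ l : ℝ} (hα : 0 < α) (hβ : 0 < β)
    (h3 : 3 = β + γ) (hj : ((j + 1 : ℕ) : ℝ) = β * n + γ) (hn : n ≤ j.choose 3)
    (hd : j + 1 < 7 + 3 * d / 2)
    (hpat : ∀ i, ∀ Q ∈ patterns d i, i = j + 1 ∧ Q.card = n ∨ (i : ℝ) < β * Q.card + γ)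
    (hl : l = α / 6 - ((j + 1).choose 3).choose n * α ^ n / (j + 1).factorial)
    (hp : ∀ m : ℕ, samplingProb m d = α * (m : ℝ) ^ (-β))
    (hb : ∀ m : ℕ, codewordBound m d = l * (m : ℝ) ^ γ) :
    ∃ m₀ : ℕ, ∀ m ≥ m₀, ∀ L : List (Finset (Fin m)), IsTripleOrder L →
      ∀ B, IsAlgorithmOutput m d L B → codewordBound m d ≤ B.card := by
  have hp1 : ∀ᶠ m : ℕ in atTop, samplingProb m d < 1 := by
    have := ((tendsto_rpow_neg_atTop hβ).comp tendsto_natCast_atTop_atTop).const_mul α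
    rw [mul_zero] at this
    simpa [hp] using this.eventually_lt_const zero_lt_one
  obtain ⟨m₀, hm₀⟩ := eventually_atTop.1
    (hp1.and (eventually_le_expectation hα h3 hj hn hd hpat hl))
  refine ⟨m₀, fun m hm L hL B hB => ?_⟩
  obtain ⟨hp1, hle⟩ := hm₀ m hm
  have hsel := condExpectation_le_selectTriples (d := d) (samplingProb_nonneg m d) hp1.le L ∅ hL.1
  have hLf : L.toFinset = powersetCard 3 univ := by
    ext T; rw [List.mem_toFinset, hL.2, mem_powersetCard_univ]
  rw [← (isAlgorithmOutput_iff hL B).1 hB, condExpectation_empty, hB.2, hLf,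
    condExpectation_eq d _ _ _ (disjoint_empty_left _), expForbidden_univ, card_powersetCard,
    card_univ, Fintype.card_fin, card_empty, hp] at hsel
  rw [hb]
  simp only [card_empty, Nat.cast_zero, zero_add, sub_zero] at hsel
  exact hle.trans hsel

lemma exists_of_mem_patterns {d j : ℕ} {Q : Finset (Finset (Fin j))} (hQ : Q ∈ patterns d j) :
    ∃ k u : ℕ, 1 ≤ k ∧ k ≤ d ∧ Q.card = k + 2 ∧ j ≤ 6 + u ∧ u * 2 ≤ 3 * k ∧
      (k = 1 → u = 0) ∧ (k = 2 → u ≤ 2) := by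
  rw [mem_patterns] at hQ
  simpa [hQ.2] using hQ.1.card_le

/-- In each case `β` and `γ` solve `β + γ = 3` and `j = βn + γ` for the extremal pair `(j, n)`, and
`α = 2c` maximizes `α/6 - N α^n / j!`, where `N` is the number of `n`-sets of triples on `j` points;
the maximum is `(1 - 1/n) α / 6`. For `d ≥ 4` configurations with more than six triples stay below
the threshold, because an extra triple adds `3/2` points on average but costs `β = 9/5`. -/
theorem codewordBound_le_card (d : ℕ) (hd : 2 ≤ d) :
    ∃ m₀ : ℕ, ∀ m ≥ m₀, ∀ L : List (Finset (Fin m)), IsTripleOrder L →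
      ∀ B, IsAlgorithmOutput m d L B → codewordBound m d ≤ B.card := by
  obtain rfl | rfl | hd4 : d = 2 ∨ d = 3 ∨ 4 ≤ d := by lia
  · set c : ℝ := (1 / 1749 : ℝ) ^ (1 / 3 : ℝ) with hc
    have hc3 : c ^ 3 = 1 / 1749 := by
      rw [hc, ← Real.rpow_natCast, ← Real.rpow_mul (by norm_num)]; norm_num
    refine eventually_codewordBound_le (j := 7) (n := 4) (α := 2 * c) (β := 5 / 3) (γ := 4 / 3)
      (l := 1 / 4 * c) (by positivity) (by norm_num) (by norm_num) (by norm_num) (by decide)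
      (by norm_num) (fun i Q hQ => ?_) ?_ (fun m => by simp only [samplingProb, if_true, hc])
      (fun m => by simp only [codewordBound, if_true, hc])
    · obtain ⟨k, u, h1, h2, h3, h4, h5, h6, h7⟩ := exists_of_mem_patterns hQ
      by_cases h : i = 8 ∧ Q.card = 4
      · exact Or.inl h
      · right
        have : 3 * i < 5 * Q.card + 4 := by lia
        have : (3 * i : ℝ) < 5 * Q.card + 4 := by exact_mod_cast this
        linarith
    · have e1 : ((7 + 1).choose 3).choose 4 = 367290 := by decide +kernel
      have : (2 * c) ^ 4 = 16 * c / 1749 := by linear_combination 16 * c * hc3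
      rw [e1, this]
      norm_num [Nat.factorial]
      ring
  · set c : ℝ := (15 / 378131 : ℝ) ^ (1 / 4 : ℝ) with hc
    have hc4 : c ^ 4 = 15 / 378131 := by
      rw [hc, ← Real.rpow_natCast, ← Real.rpow_mul (by norm_num)]; norm_num
    have hbound : 4 / ((15 : ℝ) ^ (3 / 4 : ℝ) * (378131 : ℝ) ^ (1 / 4 : ℝ)) = 4 / 15 * c := by
      have h15 : (15 : ℝ) ^ (3 / 4 : ℝ) * (15 : ℝ) ^ (1 / 4 : ℝ) = 15 := by
        rw [← Real.rpow_add (by norm_num)]; norm_num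
      rw [hc, Real.div_rpow (by norm_num) (by norm_num)]
      field_simp
      linarith
    refine eventually_codewordBound_le (j := 9) (n := 5) (α := 2 * c) (β := 7 / 4) (γ := 5 / 4)
      (l := 4 / 15 * c) (by positivity) (by norm_num) (by norm_num) (by norm_num) (by decide)
      (by norm_num) (fun i Q hQ => ?_) ?_ (fun m => by simp [samplingProb, hc])
      (fun m => by rw [← hbound]; simp [codewordBound])
    · obtain ⟨k, u, h1, h2, h3, h4, h5, h6, h7⟩ := exists_of_mem_patterns hQ
      by_cases h : i = 10 ∧ Q.card = 5
      · exact Or.inl h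
      · right
        have : 4 * i < 7 * Q.card + 5 := by lia
        have : (4 * i : ℝ) < 7 * Q.card + 5 := by exact_mod_cast this
        linarith
    · have e1 : ((9 + 1).choose 3).choose 5 = 190578024 := by decide +kernel
      have : (2 * c) ^ 5 = 32 * c * (15 / 378131) := by linear_combination 32 * c * hc4
      rw [e1, this]
      norm_num [Nat.factorial]
      ring
  · set c : ℝ := (30 / 10606681 : ℝ) ^ (1 / 5 : ℝ) with hc
    have hc5 : c ^ 5 = 30 / 10606681 := by
      rw [hc, ← Real.rpow_natCast, ← Real.rpow_mul (by norm_num)]; norm_num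
    have hbound : 5 / 3 * (5 / 10606681 : ℝ) ^ (1 / 5 : ℝ) * (6 : ℝ) ^ (-(4 / 5) : ℝ) =
        5 / 18 * c := by
      have h6 : (6 : ℝ) ^ (1 / 5 : ℝ) = 6 * (6 : ℝ) ^ (-(4 / 5) : ℝ) := by
        rw [← Real.rpow_one_add' (by norm_num) (by norm_num)]; norm_num
      have : (30 / 10606681 : ℝ) = 6 * (5 / 10606681) := by norm_num
      rw [hc, this, Real.mul_rpow (by norm_num) (by norm_num), h6]
      ring
    have h2 : d ≠ 2 := by lia
    have h3 : d ≠ 3 := by lia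
    refine eventually_codewordBound_le (j := 11) (n := 6) (α := 2 * c) (β := 9 / 5) (γ := 6 / 5)
      (l := 5 / 18 * c) (by positivity) (by norm_num) (by norm_num) (by norm_num) (by decide)
      (by lia) (fun i Q hQ => ?_) ?_ (fun m => by simp [samplingProb, hc, h2, h3])
      (fun m => by rw [← hbound]; simp [codewordBound, h2, h3])
    · obtain ⟨k, u, h1, h2, h3, h4, h5, h6, h7⟩ := exists_of_mem_patterns hQ
      by_cases h : i = 12 ∧ Q.card = 6
      · exact Or.inl h
      · right
        have : 5 * i < 9 * Q.card + 6 := by lia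
        have : (5 * i : ℝ) < 9 * Q.card + 6 := by exact_mod_cast this
        linarith
    · have e1 : ((11 + 1).choose 3).choose 6 = 147008598660 := by decide +kernel
      have : (2 * c) ^ 6 = 64 * c * (30 / 10606681) := by linear_combination 64 * c * hc5
      rw [e1, this]
      norm_num [Nat.factorial]
      ring

/-! ### Execution of programs -/

/-- The program `c` leads from the memory `s` to the memory `s'` in at most `t` steps. -/
def Exec (c : Program) (t : ℕ) (s s' : Memory) : Prop :=
  ∀ K, ∃ t' ≤ t, step^[t'] (c :: K, s) = (K, s')

namespace Exec
variable {c c₁ c₂ : Program} {b : Test} {t t₁ t₂ : ℕ} {s s₁ s₂ s' : Memory}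

lemma mono (h : Exec c t₁ s s') (ht : t₁ ≤ t₂) : Exec c t₂ s s' := fun K =>
  let ⟨t', h1, h2⟩ := h K
  ⟨t', h1.trans ht, h2⟩

lemma skip (s : Memory) : Exec .skip 1 s s := fun _ => ⟨1, le_rfl, rfl⟩

lemma instr (a : Instr) (s : Memory) : Exec (.instr a) 1 s (a.apply s) := fun _ => ⟨1, le_rfl, rfl⟩

lemma seq (h₁ : Exec c₁ t₁ s s₁) (h₂ : Exec c₂ t₂ s₁ s₂) :
    Exec (.seq c₁ c₂) (t₁ + t₂ + 1) s s₂ := by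
  intro K
  obtain ⟨u₁, hu₁, e₁⟩ := h₁ (c₂ :: K)
  obtain ⟨u₂, hu₂, e₂⟩ := h₂ K
  refine ⟨u₂ + (u₁ + 1), by lia, ?_⟩
  rw [Function.iterate_add_apply, Function.iterate_add_apply]
  change step^[u₂] (step^[u₁] (c₁ :: c₂ :: K, s)) = _
  rw [e₁, e₂]

lemma branch_true (hb : b.Holds s) (h : Exec c₁ t s s') : Exec (.branch b c₁ c₂) (t + 1) s s' := by
  intro K
  obtain ⟨u, hu, e⟩ := h K
  refine ⟨u + 1, by lia, ?_⟩
  rw [Function.iterate_add_apply, Function.iterate_one, step, if_pos hb, e]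

lemma branch_false (hb : ¬ b.Holds s) (h : Exec c₂ t s s') :
    Exec (.branch b c₁ c₂) (t + 1) s s' := by
  intro K
  obtain ⟨u, hu, e⟩ := h K
  refine ⟨u + 1, by lia, ?_⟩
  rw [Function.iterate_add_apply, Function.iterate_one, step, if_neg hb, e]

lemma loop_true (hb : b.Holds s) (h₁ : Exec c t₁ s s₁) (h₂ : Exec (.loop b c) t₂ s₁ s₂) :
    Exec (.loop b c) (t₁ + t₂ + 1) s s₂ := by
  intro K
  obtain ⟨u₁, hu₁, e₁⟩ := h₁ (.loop b c :: K)
  obtain ⟨u₂, hu₂, e₂⟩ := h₂ K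
  refine ⟨u₂ + (u₁ + 1), by lia, ?_⟩
  rw [Function.iterate_add_apply, Function.iterate_add_apply, Function.iterate_one, step,
    if_pos hb, e₁, e₂]

lemma loop_false (hb : ¬ b.Holds s) : Exec (.loop b c) 1 s s := by
  intro K
  refine ⟨1, le_rfl, ?_⟩
  rw [Function.iterate_one, step, if_neg hb]

/-- The configuration with empty stack is a fixed point of `step`, so unused steps do no harm. -/
lemma haltsWithin (h : Exec c t s s') : HaltsWithin c s t s' := by
  obtain ⟨u, hu, e⟩ := h []
  obtain ⟨v, rfl⟩ := Nat.exists_eq_add_of_le hu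
  rw [HaltsWithin, add_comm, Function.iterate_add_apply, e]
  exact Function.iterate_fixed rfl v

end Exec

/-- A sequence of instructions. -/
def block : List Instr → Program
  | [] => .skip
  | a :: l => .seq (.instr a) (block l)

/-- The effect of a sequence of instructions. -/
def runBlock (l : List Instr) (s : Memory) : Memory := l.foldl (fun s a => a.apply s) s

lemma exec_block (l : List Instr) (s : Memory) :
    Exec (block l) (2 * l.length + 1) s (runBlock l s) := by
  induction l generalizing s with
  | nil => exact .skip s
  | cons a l ih =>
    refine ((Exec.instr a s).seq (ih _)).mono ?_
    rw [List.length_cons]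
    lia

/-! ### Nested loops over decreasing tuples -/

/-- The extensions `x ++ l` of `l` by an increasing list `x` of `k` numbers less than `n`, in
the order in which nested loops run through them. -/
def enum : ℕ → ℕ → List ℕ → List (List ℕ)
  | 0, _, l => [l]
  | k + 1, n, l => (List.range n).flatMap fun x => enum k x (x :: l)

/-- The outermost loop fixes the largest, hence last, entry of `x`, and each inner loop stays below
the counter around it. -/
lemma mem_enum {k n : ℕ} {l l' : List ℕ} :
    l' ∈ enum k n l ↔ ∃ x, l' = x ++ l ∧ x.length = k ∧ x.Pairwise (· < ·) ∧ ∀ a ∈ x, a < n := by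
  induction k generalizing n l with
  | zero =>
    simp only [enum, List.mem_singleton, List.length_eq_zero_iff]
    constructor
    · rintro rfl; exact ⟨[], by simp⟩
    · rintro ⟨x, rfl, rfl, -⟩; simp
  | succ k ih =>
    simp only [enum, List.mem_flatMap, List.mem_range, ih]
    constructor
    · rintro ⟨a, ha, x, rfl, rfl, hx, hlt⟩
      refine ⟨x ++ [a], by simp, by simp, ?_, ?_⟩
      · rw [List.pairwise_append]
        exact ⟨hx, List.pairwise_singleton _ _, by simpa using hlt⟩
      · intro b hb
        rcases List.mem_append.1 hb with h | h
        · exact (hlt b h).trans ha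
        · rwa [List.mem_singleton.1 h]
    · rintro ⟨x, rfl, hk, hx, hlt⟩
      rcases List.eq_nil_or_concat x with rfl | ⟨y, a, rfl⟩
      · simp at hk
      · rw [List.concat_eq_append] at *
        rw [List.pairwise_append] at hx
        refine ⟨a, hlt a (by simp), y, by simp, by simpa using hk, hx.1, fun b hb => ?_⟩
        exact hx.2.2 b hb a (by simp)

lemma nodup_enum (k n : ℕ) (l : List ℕ) : (enum k n l).Nodup := by
  induction k generalizing n l with
  | zero => simp [enum]
  | succ k ih =>
    rw [enum, List.nodup_flatMap]
    refine ⟨fun x _ => ih _ _, List.nodup_range.imp fun {a b} hab => ?_⟩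
    intro l' ha hb
    obtain ⟨x, rfl, hx, -⟩ := mem_enum.1 ha
    obtain ⟨y, hy, hyk, -⟩ := mem_enum.1 hb
    have := List.append_inj hy (hx.trans hyk.symm)
    simp only [List.cons.injEq, and_true] at this
    exact hab this.2

/-- Nested loops: `N[b + 3]` runs through the numbers less than `N[b]`, `N[b + 6]` runs through the
numbers less than `N[b + 3]`, and so on; with a counter `x` in `N[i]`, the cells `N[i + 1]` and
`N[i + 2]` contain `x * m` and `x * m ^ 2`. -/
def nest (body : Program) : ℕ → ℕ → Program
  | 0, _ => body
  | k + 1, b =>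
    .seq (block [.constN (b + 3) 0, .constN (b + 4) 0, .constN (b + 5) 0])
      (.loop (.ltN (b + 3) b) (.seq (nest body k (b + 3))
        (block [.addN (b + 3) (b + 3) 2, .addN (b + 4) (b + 4) 0, .addN (b + 5) (b + 5) 3])))

/-- A bound for the running time of nested loops. -/
def nestTime (t m : ℕ) : ℕ → ℕ
  | 0 => t
  | k + 1 => m * (nestTime t m k + 9) + 9

/-- The overhead `9 * m + 9` of one level is at most `18 * m ^ (k + 1)`. -/
lemma nestTime_le (t : ℕ) {m : ℕ} (hm : 1 ≤ m) (k : ℕ) : nestTime t m k ≤ m ^ k * (t + 18 * k) := by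
  induction k with
  | zero => simp [nestTime]
  | succ k ih =>
    have h1 : 1 ≤ m ^ k := Nat.one_le_pow _ _ hm
    have h2 : m * (nestTime t m k + 9) ≤ m * (m ^ k * (t + 18 * k) + 9) := by gcongr
    have h3 : m ≤ m * m ^ k := Nat.le_mul_of_pos_right m h1
    have h4 : m ^ (k + 1) * (t + 18 * (k + 1)) =
      m * (m ^ k * (t + 18 * k)) + 18 * (m * m ^ k) := by ring
    rw [nestTime, h4]
    lia

/-- The cells of the loop counters contain the entries of `l`; the innermost loop belongs to
the first entry. -/
def Levels (m b : ℕ) (s : Memory) : List ℕ → Prop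
  | [] => s.nat b = m
  | x :: l => s.nat (b + 3 * (l.length + 1)) = x ∧ s.nat (b + 3 * (l.length + 1) + 1) = x * m ∧
      s.nat (b + 3 * (l.length + 1) + 2) = x * (m * m) ∧ Levels m b s l

lemma Levels.congr {m b : ℕ} {s s' : Memory} {l : List ℕ} (h : Levels m b s l)
    (hs : ∀ i, b ≤ i → i < b + 3 * (l.length + 1) → s'.nat i = s.nat i) : Levels m b s' l := by
  induction l with
  | nil => rw [Levels, hs b le_rfl (by simp)]; exact h
  | cons x l ih =>
    obtain ⟨h1, h2, h3, h4⟩ := h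
    rw [List.length_cons] at hs
    refine ⟨?_, ?_, ?_, ih h4 fun i h h' => hs i h (by lia)⟩
    · rw [hs _ (by lia) (by lia), h1]
    · rw [hs _ (by lia) (by lia), h2]
    · rw [hs _ (by lia) (by lia), h3]

lemma Levels.get {m b : ℕ} {s : Memory} {l : List ℕ} (h : Levels m b s l) (i : ℕ)
    (hi : i < l.length) :
    s.nat (b + 3 * (l.length - i)) = l[i] ∧ s.nat (b + 3 * (l.length - i) + 1) = l[i] * m ∧
      s.nat (b + 3 * (l.length - i) + 2) = l[i] * (m * m) := by
  induction l generalizing i with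
  | nil => simp at hi
  | cons x l ih =>
    cases i with
    | zero => exact ⟨h.1, h.2.1, h.2.2.1⟩
    | succ i =>
      have := ih h.2.2.2 i (by simpa using hi)
      simpa using this

/-- The rule for nested loops, with an invariant that depends on the list of the
tuples that remain to be processed. -/
theorem exec_nest {m b K t : ℕ} {body : Program} {Inv : List (List ℕ) → Memory → Prop}
    (hb : 3 ≤ b)
    (hconst : ∀ r s, Inv r s → s.nat 0 = m ∧ s.nat 2 = 1 ∧ s.nat 3 = m * m)
    (hstab : ∀ r s s', Inv r s → s'.real = s.real →
      (∀ i, (i < b + 3 ∨ b + 3 * (K + 1) ≤ i) → s'.nat i = s.nat i) → Inv r s')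
    (hbody : ∀ l r s, Inv (l :: r) s → l ∈ enum K m [] → Levels m b s l →
      ∃ s', Exec body t s s' ∧ Inv r s' ∧
        ∀ i, b ≤ i → i < b + 3 * (K + 1) → s'.nat i = s.nat i) :
    ∀ k l n r s, l.length + k = K → n ≤ m → s.nat (b + 3 * l.length) = n → Levels m b s l →
      (∀ l' ∈ enum k n l, l' ∈ enum K m []) → Inv (enum k n l ++ r) s →
      ∃ s', Exec (nest body k (b + 3 * l.length)) (nestTime t m k) s s' ∧ Inv r s' ∧
        ∀ i, b ≤ i → i < b + 3 * (l.length + 1) → s'.nat i = s.nat i := by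
  intro k
  induction k with
  | zero =>
    intro l n r s hK hn hs hl hsub hInv
    obtain ⟨s', h1, h2, h3⟩ := hbody l r s hInv (hsub l (by simp [enum])) hl
    exact ⟨s', h1, h2, fun i hi hi' => h3 i hi (by lia)⟩
  | succ k ih =>
    intro l n r s hK hn hs hl hsub hInv
    set c := b + 3 * l.length with hc
    -- Induction on the number `q` of rounds left, with counter value `x`. The multiples `x * m` and
    -- `x * (m * m)` are updated by addition, since the machine cannot multiply natural numbers.
    have hloop : ∀ q x s, x + q = n → s.nat c = n → Levels m b s (x :: l) →
        Inv ((List.range' x q).flatMap (fun x => enum k x (x :: l)) ++ r) s →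
        ∃ s', Exec (.loop (.ltN (c + 3) c) (.seq (nest body k (c + 3))
          (block [.addN (c + 3) (c + 3) 2, .addN (c + 4) (c + 4) 0, .addN (c + 5) (c + 5) 3])))
          (q * (nestTime t m k + 9) + 1) s s' ∧ Inv r s' ∧
          ∀ i, b ≤ i → i < b + 3 * (l.length + 1) → s'.nat i = s.nat i := by
      intro q
      induction q with
      | zero =>
        intro x s hx hs hl hInv
        refine ⟨s, (Exec.loop_false ?_).mono (by lia), by simpa using hInv, fun _ _ _ => rfl⟩
        have h1 : s.nat (c + 3) = x := hl.1
        simp only [Test.Holds, h1, hs]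
        lia
      | succ q ihq =>
        intro x s hx hs hl hInv
        have h1 : s.nat (c + 3) = x := hl.1
        rw [List.range'_succ, List.flatMap_cons, List.append_assoc] at hInv
        obtain ⟨s₁, he₁, hi₁, hf₁⟩ := ih (x :: l) x _ s (by rw [List.length_cons]; lia) (by lia)
          (by simpa [hc, Nat.mul_add, Nat.add_assoc] using h1) hl
          (fun l' hl' => hsub l' (by
            rw [enum, List.mem_flatMap]
            exact ⟨x, List.mem_range.2 (by lia), hl'⟩)) hInv
        rw [List.length_cons] at hf₁
        have hcell : b + 3 * (x :: l).length = c + 3 := by rw [List.length_cons]; lia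
        rw [hcell] at he₁
        obtain ⟨k0, k2, k3⟩ := hconst _ _ hi₁
        have g3 : s₁.nat (c + 3) = x := by rw [hf₁ _ (by lia) (by lia)]; exact hl.1
        have g4 : s₁.nat (c + 4) = x * m := by rw [hf₁ _ (by lia) (by lia)]; exact hl.2.1
        have g5 : s₁.nat (c + 5) = x * (m * m) := by rw [hf₁ _ (by lia) (by lia)]; exact hl.2.2.1
        set B := [Instr.addN (c + 3) (c + 3) 2, .addN (c + 4) (c + 4) 0, .addN (c + 5) (c + 5) 3]
          with hB
        have hr : (runBlock B s₁).real = s₁.real := rfl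
        have hn : ∀ i, (i < c + 3 ∨ c + 6 ≤ i) → (runBlock B s₁).nat i = s₁.nat i := by
          intro i hi
          have i3 : i ≠ c + 3 := by lia
          have i4 : i ≠ c + 4 := by lia
          have i5 : i ≠ c + 5 := by lia
          simp [hB, runBlock, Instr.apply, Function.update_apply, i3, i4, i5]
        have n3 : (runBlock B s₁).nat (c + 3) = x + 1 := by
          simp [hB, runBlock, Instr.apply, Function.update_apply, g3, k2]
        have n4 : (runBlock B s₁).nat (c + 4) = (x + 1) * m := by
          simp [hB, runBlock, Instr.apply, Function.update_apply, g4, k0]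
          ring
        have n5 : (runBlock B s₁).nat (c + 5) = (x + 1) * (m * m) := by
          have e0 : c ≠ 0 := by lia
          simp [hB, runBlock, Instr.apply, g5, k3, e0]
          ring
        obtain ⟨s₂, he₂, hi₂, hf₂⟩ := ihq (x + 1) (runBlock B s₁) (by lia)
          (by rw [hn _ (by lia), hf₁ _ (by lia) (by lia), hs])
          ⟨n3, n4, n5, hl.2.2.2.congr fun i h h' => by
            rw [hn _ (by lia), hf₁ _ (by lia) (by lia)]⟩
          (hstab _ _ _ hi₁ hr fun i hi => hn i (by lia))
        refine ⟨s₂, (Exec.loop_true ?_ (he₁.seq (exec_block B s₁)) he₂).mono ?_, hi₂, ?_⟩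
        · simp only [Test.Holds, h1, hs]
          lia
        · simp only [hB, List.length_cons, List.length_nil]
          have : (q + 1) * (nestTime t m k + 9) =
            q * (nestTime t m k + 9) + (nestTime t m k + 9) := by ring
          lia
        · intro i h h'
          rw [hf₂ i h h', hn _ (by lia), hf₁ _ h (by lia)]
    set B := [Instr.constN (c + 3) 0, .constN (c + 4) 0, .constN (c + 5) 0] with hB
    have hnat : ∀ i, (i < c + 3 ∨ c + 6 ≤ i) → (runBlock B s).nat i = s.nat i := by
      intro i hi
      have i3 : i ≠ c + 3 := by lia
      have i4 : i ≠ c + 4 := by lia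
      have i5 : i ≠ c + 5 := by lia
      simp [hB, runBlock, Instr.apply, i3, i4, i5]
    have h0 : ∀ i, c + 3 ≤ i → i < c + 6 → (runBlock B s).nat i = 0 := by
      intro i h h'
      obtain rfl | rfl | rfl : i = c + 3 ∨ i = c + 4 ∨ i = c + 5 := by lia
      all_goals simp [hB, runBlock, Instr.apply]
    obtain ⟨s', he, hi, hf⟩ := hloop n 0 (runBlock B s) (by lia) (by rw [hnat _ (by lia), hs])
      ⟨h0 _ (by lia) (by lia), by rw [h0 _ (by lia) (by lia), zero_mul],
        by rw [h0 _ (by lia) (by lia), zero_mul],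
        hl.congr fun i h h' => hnat i (by lia)⟩
      (hstab _ s _ (by rwa [enum, List.range_eq_range'] at hInv) rfl fun i hi => hnat i (by lia))
    refine ⟨s', ((exec_block B s).seq he).mono ?_, hi, fun i h h' => ?_⟩
    · simp only [hB, List.length_cons, List.length_nil, nestTime]
      have : n * (nestTime t m k + 9) ≤ m * (nestTime t m k + 9) := Nat.mul_le_mul_right _ hn
      lia
    · rw [hf i h h', hnat _ (by lia)]

/-- The rule for complete nested loops. -/
theorem exec_nest_nil {m b K t : ℕ} {body : Program} {Inv : List (List ℕ) → Memory → Prop}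
    (hb : 3 ≤ b)
    (hconst : ∀ r s, Inv r s → s.nat 0 = m ∧ s.nat 2 = 1 ∧ s.nat 3 = m * m)
    (hstab : ∀ r s s', Inv r s → s'.real = s.real →
      (∀ i, (i < b + 3 ∨ b + 3 * (K + 1) ≤ i) → s'.nat i = s.nat i) → Inv r s')
    (hbody : ∀ l r s, Inv (l :: r) s → l ∈ enum K m [] → Levels m b s l →
      ∃ s', Exec body t s s' ∧ Inv r s' ∧
        ∀ i, b ≤ i → i < b + 3 * (K + 1) → s'.nat i = s.nat i)
    {s : Memory} (hs : s.nat b = m) (hInv : Inv (enum K m []) s) :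
    ∃ s', Exec (nest body K b) (nestTime t m K) s s' ∧ Inv [] s' := by
  obtain ⟨s', h1, h2, -⟩ := exec_nest hb hconst hstab hbody K [] m [] s (by simp) le_rfl hs hs
    (fun _ h => h) (by simpa using hInv)
  exact ⟨s', h1, h2⟩

/-! ### Tuples and sets of points -/

/-- The set of points in `Fin m` that are listed in `l`. -/
def pointSet (m : ℕ) (l : List ℕ) : Finset (Fin m) := univ.filter fun v => v.val ∈ l

lemma mem_enum_nil {k n : ℕ} {l : List ℕ} :
    l ∈ enum k n [] ↔ l.length = k ∧ l.Pairwise (· < ·) ∧ ∀ a ∈ l, a < n := by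
  rw [mem_enum]
  constructor
  · rintro ⟨x, rfl, h⟩; simpa using h
  · intro h; exact ⟨l, by simp, h⟩

/-- An increasing tuple as an injection. -/
def tupleEmb {k m : ℕ} {l : List ℕ} (hl : l ∈ enum k m []) : Fin k ↪ Fin m where
  toFun i := ⟨l[i]'((mem_enum_nil.1 hl).1.symm ▸ i.2), (mem_enum_nil.1 hl).2.2 _ (by simp)⟩
  inj' i j h := by
    have hnd : l.Nodup := (mem_enum_nil.1 hl).2.1.imp fun h => h.ne
    simp only [Fin.mk.injEq] at h
    exact Fin.ext ((hnd.getElem_inj_iff).1 h)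

lemma tupleEmb_lt {k m : ℕ} {l : List ℕ} (hl : l ∈ enum k m []) {i j : Fin k} (h : i < j) :
    tupleEmb hl i < tupleEmb hl j :=
  List.pairwise_iff_getElem.1 (mem_enum_nil.1 hl).2.1 _ _ _ _ h

lemma pointSet_eq_map {k m : ℕ} {l : List ℕ} (hl : l ∈ enum k m []) :
    pointSet m l = univ.map (tupleEmb hl) := by
  ext v
  simp only [pointSet, mem_filter, mem_univ, true_and, mem_map, List.mem_iff_getElem]
  constructor
  · rintro ⟨i, hi, h⟩
    exact ⟨⟨i, (mem_enum_nil.1 hl).1 ▸ hi⟩, Fin.ext h⟩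
  · rintro ⟨i, rfl⟩
    exact ⟨i, _, rfl⟩

/-- An increasing list is determined by its set of entries. -/
lemma nodup_map_pointSet (k m : ℕ) : ((enum k m []).map (pointSet m)).Nodup := by
  refine (nodup_enum k m []).map_on fun l hl l' hl' h => ?_
  rw [mem_enum_nil] at hl hl'
  have hmem : ∀ a, a ∈ l ↔ a ∈ l' := by
    intro a
    by_cases ha : a < m
    · have := Finset.ext_iff.1 h ⟨a, ha⟩
      simpa [pointSet] using this
    · exact iff_of_false (fun h => ha (hl.2.2 a h)) (fun h => ha (hl'.2.2 a h))
  exact ((List.perm_ext_iff_of_nodup (hl.2.1.imp fun h => h.ne) (hl'.2.1.imp fun h => h.ne)).2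
    hmem).eq_of_pairwise (fun a b _ _ h h' => absurd h h'.asymm) hl.2.1 hl'.2.1

lemma mem_map_pointSet {k m : ℕ} {S : Finset (Fin m)} :
    S ∈ (enum k m []).map (pointSet m) ↔ S.card = k := by
  rw [List.mem_map]
  constructor
  · rintro ⟨l, hl, rfl⟩
    rw [pointSet_eq_map hl, card_map, card_univ, Fintype.card_fin]
  · intro h
    refine ⟨(S.map Fin.valEmbedding).sort (· ≤ ·), mem_enum_nil.2 ⟨by simpa using h, ?_, ?_⟩, ?_⟩
    · exact (sortedLT_sort _).pairwise
    · intro a ha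
      rw [mem_sort, mem_map] at ha
      obtain ⟨v, -, rfl⟩ := ha
      exact v.2
    · ext v
      simp [pointSet, Fin.val_inj]

lemma isTripleOrder_enum (m : ℕ) : IsTripleOrder ((enum 3 m []).map (pointSet m)) :=
  ⟨nodup_map_pointSet 3 m, fun _ => mem_map_pointSet⟩

lemma sum_enum {k m : ℕ} (f : Finset (Fin m) → ℝ) :
    ((enum k m []).map fun l => f (pointSet m l)).sum = ∑ S ∈ powersetCard k univ, f S := by
  have : powersetCard k univ = ((enum k m []).map (pointSet m)).toFinset := by
    ext S; rw [List.mem_toFinset, mem_map_pointSet, mem_powersetCard_univ]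
  rw [this, List.sum_toFinset _ (nodup_map_pointSet k m), List.map_map]
  rfl

/-! ### The computation of the expected number of forbidden configurations -/

/-- The numbers `w T` are stored in the real memory for all triples `T`. -/
def Stores (m : ℕ) (s : Memory) (w : Finset (Fin m) → ℝ) : Prop :=
  ∀ z y x : Fin m, z < y → y < x → s.real (16 + x * (m * m) + y * m + z) = w {z, y, x}

/-- The instructions that multiply `R[2]` by the number that is stored for the triple `A`. The
points of `A` are given by the counters of `j` nested loops. -/
def tripleCode (j : ℕ) (A : Finset (Fin j)) : List Instr :=
  if h : A.card = 3 then
    [.addN 7 4 (24 + 3 * (j - A.orderEmbOfFin h 2) + 2),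
      .addN 7 7 (24 + 3 * (j - A.orderEmbOfFin h 1) + 1),
      .addN 7 7 (24 + 3 * (j - A.orderEmbOfFin h 0)), .loadR 3 7, .mulR 2 2 3]
  else []

/-- The instructions that add to `R[0]` the product of the numbers that are stored for the triples
of the configuration `Q`. -/
def patternCode (j : ℕ) (Q : Finset (Finset (Fin j))) : List Instr :=
  .castR 2 2 :: (Q.toList.flatMap (tripleCode j) ++ [.addR 0 0 2])

/-- The memory `s'` differs from `s` at most in the scratch cells `N[7]` and `R[0]`, …, `R[3]`. -/
def SameUpToScratch (s s' : Memory) : Prop :=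
  (∀ i, i ≠ 7 → s'.nat i = s.nat i) ∧ ∀ i, 4 ≤ i → s'.real i = s.real i

lemma SameUpToScratch.trans {s s' s'' : Memory} (h : SameUpToScratch s s')
    (h' : SameUpToScratch s' s'') : SameUpToScratch s s'' :=
  ⟨fun i hi => (h'.1 i hi).trans (h.1 i hi), fun i hi => (h'.2 i hi).trans (h.2 i hi)⟩

/-- The counters of the loops contain the tuple `l`, and the numbers `w T` are stored. -/
structure Ready (m : ℕ) (l : List ℕ) (w : Finset (Fin m) → ℝ) (s : Memory) : Prop where
  one : s.nat 2 = 1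
  base : s.nat 4 = 16
  levels : Levels m 24 s l
  stores : Stores m s w

lemma Ready.same {m : ℕ} {l : List ℕ} {w : Finset (Fin m) → ℝ} {s s' : Memory}
    (h : Ready m l w s) (hs : SameUpToScratch s s') : Ready m l w s' where
  one := by rw [hs.1 2 (by norm_num), h.one]
  base := by rw [hs.1 4 (by norm_num), h.base]
  levels := h.levels.congr fun i hi _ => hs.1 i (by lia)
  stores z y x hzy hyx := by rw [hs.2 _ (by lia), h.stores z y x hzy hyx]

lemma runBlock_append (l₁ l₂ : List Instr) (s : Memory) :
    runBlock (l₁ ++ l₂) s = runBlock l₂ (runBlock l₁ s) :=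
  List.foldl_append ..

/-- Both `A.orderEmbOfFin` and `tupleEmb` are increasing, so the image triple is met in the order
required by `Stores`: its largest point supplies the multiple of `m * m`, the middle one that of
`m`. -/
lemma runBlock_tripleCode {m j : ℕ} {l : List ℕ} {w : Finset (Fin m) → ℝ} {s : Memory}
    (hs : Ready m l w s) (hl : l ∈ enum j m []) {A : Finset (Fin j)} (hA : A.card = 3) :
    SameUpToScratch s (runBlock (tripleCode j A) s) ∧
      (runBlock (tripleCode j A) s).real 0 = s.real 0 ∧
      (runBlock (tripleCode j A) s).real 2 = s.real 2 * w (A.map (tupleEmb hl)) := by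
  have hlen : l.length = j := (mem_enum_nil.1 hl).1
  set e := A.orderEmbOfFin hA with he
  have hget : ∀ i : Fin 3, s.nat (24 + 3 * (j - e i)) = tupleEmb hl (e i) ∧
      s.nat (24 + 3 * (j - e i) + 1) = tupleEmb hl (e i) * m ∧
      s.nat (24 + 3 * (j - e i) + 2) = tupleEmb hl (e i) * (m * m) := by
    intro i
    have := hs.levels.get (e i) (hlen.symm ▸ (e i).2)
    simp only [hlen] at this
    exact this
  have hmap : A.map (tupleEmb hl) =
      {tupleEmb hl (e 0), tupleEmb hl (e 1), tupleEmb hl (e 2)} := by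
    have : A = {e 0, e 1, e 2} := by
      ext v
      have h : v ∈ A ↔ ∃ i, e i = v := by
        rw [← mem_coe, ← A.range_orderEmbOfFin hA, Set.mem_range]
      rw [h]
      simp [Fin.exists_fin_succ, eq_comm]
    conv_lhs => rw [this]
    simp [map_insert]
  have hst := hs.stores (tupleEmb hl (e 0)) (tupleEmb hl (e 1)) (tupleEmb hl (e 2))
    (tupleEmb_lt hl (e.strictMono (by decide))) (tupleEmb_lt hl (e.strictMono (by decide)))
  rw [← hmap] at hst
  -- The partial address in `N[7]` must not overwrite a counter read afterwards; the second counter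
  -- is read at offset `1`, hence `6`.
  have c1 : 24 + 3 * (j - (e 1 : ℕ)) ≠ 6 := by lia
  have c0 : 24 + 3 * (j - (e 0 : ℕ)) ≠ 7 := by lia
  rw [tripleCode, dif_pos hA, ← he]
  refine ⟨⟨fun i hi => ?_, fun i hi => ?_⟩, ?_, ?_⟩
  · simp [runBlock, Instr.apply, hi]
  · have h2 : i ≠ 2 := by lia
    have h3 : i ≠ 3 := by lia
    simp [runBlock, Instr.apply, h2, h3]
  · simp [runBlock, Instr.apply]
  · rw [← hst, ← (hget 2).2.2, ← (hget 1).2.1, ← (hget 0).1, ← hs.base]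
    simp [runBlock, Instr.apply, c1, c0]

lemma runBlock_flatMap_tripleCode {m j : ℕ} {l : List ℕ} {w : Finset (Fin m) → ℝ}
    (hl : l ∈ enum j m []) (As : List (Finset (Fin j))) :
    ∀ s, Ready m l w s → (∀ A ∈ As, A.card = 3) →
      SameUpToScratch s (runBlock (As.flatMap (tripleCode j)) s) ∧
      (runBlock (As.flatMap (tripleCode j)) s).real 0 = s.real 0 ∧
      (runBlock (As.flatMap (tripleCode j)) s).real 2 =
        s.real 2 * (As.map fun A => w (A.map (tupleEmb hl))).prod := by
  induction As with
  | nil => intro s _ _; simp [runBlock, SameUpToScratch]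
  | cons A As ih =>
    intro s hs hAs
    obtain ⟨h1, h2, h3⟩ := runBlock_tripleCode hs hl (hAs A (by simp))
    obtain ⟨h4, h5, h6⟩ := ih _ (hs.same h1) fun B hB => hAs B (by simp [hB])
    rw [List.flatMap_cons, runBlock_append]
    refine ⟨h1.trans h4, h5.trans h2, ?_⟩
    rw [h6, h3, List.map_cons, List.prod_cons, mul_assoc]

lemma runBlock_patternCode {m j : ℕ} {l : List ℕ} {w : Finset (Fin m) → ℝ} {s : Memory}
    (hs : Ready m l w s) (hl : l ∈ enum j m []) {Q : Finset (Finset (Fin j))}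
    (hQ : ∀ A ∈ Q, A.card = 3) :
    SameUpToScratch s (runBlock (patternCode j Q) s) ∧
      (runBlock (patternCode j Q) s).real 0 =
        s.real 0 + ∏ A ∈ Q, w (A.map (tupleEmb hl)) := by
  -- The product register starts at `1` because `N[2] = 1`.
  have h0 : SameUpToScratch s (Instr.apply s (.castR 2 2)) := by
    refine ⟨fun i _ => rfl, fun i hi => ?_⟩
    have h2 : i ≠ 2 := by lia
    simp [Instr.apply, h2]
  obtain ⟨h1, h2, h3⟩ := runBlock_flatMap_tripleCode hl Q.toList _ (hs.same h0)
    (fun A hA => hQ A (mem_toList.1 hA))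
  have hrun : runBlock (patternCode j Q) s =
      runBlock [.addR 0 0 2] (runBlock (Q.toList.flatMap (tripleCode j))
        (Instr.apply s (.castR 2 2))) := by
    rw [patternCode, ← runBlock_append]; rfl
  rw [hrun]
  generalize runBlock (Q.toList.flatMap (tripleCode j)) (Instr.apply s (.castR 2 2)) = s₁ at *
  have h4 : SameUpToScratch s₁ (runBlock [.addR 0 0 2] s₁) := by
    refine ⟨fun i _ => rfl, fun i hi => ?_⟩
    have h2 : i ≠ 0 := by lia
    simp [runBlock, Instr.apply, h2]
  refine ⟨(h0.trans h1).trans h4, ?_⟩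
  have : (runBlock [.addR 0 0 2] s₁).real 0 = s₁.real 0 + s₁.real 2 := by
    simp [runBlock, Instr.apply]
  rw [this, h2, h3, prod_map_toList]
  simp [Instr.apply, hs.one]

/-- The instructions that process all patterns on `j` points. -/
def levelCode (d j : ℕ) : List Instr := (patterns d j).toList.flatMap (patternCode j)

/-- The patterns on `j` points are unrolled into straight-line code, so the cost per tuple is
independent of `m`. -/
lemma runBlock_levelCode {m d j : ℕ} {l : List ℕ} {w : Finset (Fin m) → ℝ} {s : Memory}
    (hs : Ready m l w s) (hl : l ∈ enum j m []) :
    SameUpToScratch s (runBlock (levelCode d j) s) ∧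
      (runBlock (levelCode d j) s).real 0 =
        s.real 0 + ∑ C ∈ (forbidden (Fin m) d).filter (fun C => C.biUnion id = pointSet m l),
          ∏ A ∈ C, w A := by
  rw [pointSet_eq_map hl, sum_forbidden_filter_eq, ← sum_map_toList]
  have hQ : ∀ Q ∈ (patterns d j).toList, ∀ A ∈ Q, A.card = 3 := fun Q hQ =>
    (mem_patterns.1 (mem_toList.1 hQ)).1.1
  rw [levelCode]
  generalize (patterns d j).toList = Qs at *
  induction Qs generalizing s with
  | nil => simp [runBlock, SameUpToScratch]
  | cons Q Qs ih =>
    obtain ⟨h1, h2⟩ := runBlock_patternCode hs hl (hQ Q (by simp))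
    obtain ⟨h3, h4⟩ := ih (hs.same h1) fun Q' h => hQ Q' (by simp [h])
    rw [List.flatMap_cons, runBlock_append]
    refine ⟨h1.trans h3, ?_⟩
    rw [h4, h2, List.map_cons, List.sum_cons, add_assoc]

/-- The program that adds to `R[0]` the contribution of the configurations that cover fewer than
`J` points. -/
def forbiddenProgram (d : ℕ) : ℕ → Program
  | 0 => .skip
  | J + 1 => .seq (forbiddenProgram d J) (nest (block (levelCode d J)) J 24)

/-- The memory `s'` differs from `s` at most in the scratch cells, where the counters of up to `W`
nested loops are scratch cells as well. -/
def SameOutsideLoops (W : ℕ) (s s' : Memory) : Prop :=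
  (∀ i, i ≠ 7 → (i < 27 ∨ 27 + 3 * W ≤ i) → s'.nat i = s.nat i) ∧
    ∀ i, 4 ≤ i → s'.real i = s.real i

lemma SameOutsideLoops.stores {m W : ℕ} {s s' : Memory} {w : Finset (Fin m) → ℝ}
    (h : SameOutsideLoops W s s') (hs : Stores m s w) : Stores m s' w :=
  fun z y x hzy hyx => by rw [h.2 _ (by lia), hs z y x hzy hyx]

lemma exec_nest_levelCode {m d j W : ℕ} (hj : j ≤ W) {s : Memory} {w : Finset (Fin m) → ℝ}
    (h0 : s.nat 0 = m) (h2 : s.nat 2 = 1) (h3 : s.nat 3 = m * m) (h4 : s.nat 4 = 16)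
    (h24 : s.nat 24 = m) (hw : Stores m s w) :
    ∃ s', Exec (nest (block (levelCode d j)) j 24)
        (nestTime (2 * (levelCode d j).length + 1) m j) s s' ∧ SameOutsideLoops W s s' ∧
      s'.real 0 = s.real 0 + ∑ S ∈ powersetCard j univ,
        ∑ C ∈ (forbidden (Fin m) d).filter (fun C => C.biUnion id = S), ∏ A ∈ C, w A := by
  set f : Finset (Fin m) → ℝ := fun S =>
    ∑ C ∈ (forbidden (Fin m) d).filter (fun C => C.biUnion id = S), ∏ A ∈ C, w A with hf
  -- The invariant: `R[0]` plus the contributions of the tuples still to come is constant.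
  obtain ⟨s', he, hs, hr⟩ := exec_nest_nil (m := m) (b := 24) (K := j)
    (t := 2 * (levelCode d j).length + 1) (body := block (levelCode d j))
    (Inv := fun r s' => SameOutsideLoops W s s' ∧
      s'.real 0 + (r.map fun l => f (pointSet m l)).sum =
        s.real 0 + ((enum j m []).map fun l => f (pointSet m l)).sum)
    (by norm_num)
    (fun r s' h => ⟨(h.1.1 0 (by norm_num) (by norm_num)).trans h0,
      (h.1.1 2 (by norm_num) (by norm_num)).trans h2,
      (h.1.1 3 (by norm_num) (by norm_num)).trans h3⟩)
    (fun r s₁ s₂ h hr hn => by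
      refine ⟨⟨fun i hi hi' => ?_, fun i hi => ?_⟩, ?_⟩
      · rw [hn i (by lia), h.1.1 i hi hi']
      · rw [hr, h.1.2 i hi]
      · rw [hr, h.2])
    (fun l r s₁ h hl hlev => by
      have hready : Ready m l w s₁ :=
        ⟨(h.1.1 2 (by norm_num) (by norm_num)).trans h2,
          (h.1.1 4 (by norm_num) (by norm_num)).trans h4, hlev, h.1.stores hw⟩
      obtain ⟨g1, g2⟩ := runBlock_levelCode (d := d) hready hl
      refine ⟨_, exec_block _ _, ⟨⟨fun i hi hi' => ?_, fun i hi => ?_⟩, ?_⟩, fun i hi hi' => ?_⟩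
      · rw [g1.1 i hi, h.1.1 i hi hi']
      · rw [g1.2 i hi, h.1.2 i hi]
      · rw [← h.2, g2, List.map_cons, List.sum_cons, ← add_assoc]
      · exact g1.1 i (by lia))
    h24 ⟨⟨fun _ _ _ => rfl, fun _ _ => rfl⟩, rfl⟩
  refine ⟨s', he, hs, ?_⟩
  rw [sum_enum] at hr
  simpa using hr

lemma exec_forbiddenProgram_aux (d W J : ℕ) (hJ : J ≤ W + 1) :
    ∃ K, ∀ (m : ℕ) (s : Memory) (w : Finset (Fin m) → ℝ), 1 ≤ m → s.nat 0 = m → s.nat 2 = 1 →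
      s.nat 3 = m * m → s.nat 4 = 16 → s.nat 24 = m → Stores m s w →
      ∃ s', Exec (forbiddenProgram d J) (K * m ^ W) s s' ∧ SameOutsideLoops W s s' ∧
        s'.real 0 = s.real 0 + ∑ j ∈ range J, ∑ S ∈ powersetCard j univ,
          ∑ C ∈ (forbidden (Fin m) d).filter (fun C => C.biUnion id = S), ∏ A ∈ C, w A := by
  induction J with
  | zero =>
    refine ⟨1, fun m s w hm _ _ _ _ _ _ => ⟨s, (Exec.skip s).mono ?_,
      ⟨fun _ _ _ => rfl, fun _ _ => rfl⟩, by simp⟩⟩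
    rw [one_mul]
    exact Nat.one_le_pow _ _ hm
  | succ J ih =>
    obtain ⟨K, hK⟩ := ih (by lia)
    refine ⟨K + (2 * (levelCode d J).length + 1 + 18 * J) + 1,
      fun m s w hm h0 h2 h3 h4 h24 hw => ?_⟩
    obtain ⟨s₁, he₁, hs₁, hr₁⟩ := hK m s w hm h0 h2 h3 h4 h24 hw
    have hc : ∀ i, i ≠ 7 → i < 27 → s₁.nat i = s.nat i := fun i hi hi' => hs₁.1 i hi (Or.inl hi')
    obtain ⟨s₂, he₂, hs₂, hr₂⟩ := exec_nest_levelCode (d := d) (j := J) (W := W) (by lia)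
      ((hc 0 (by norm_num) (by norm_num)).trans h0) ((hc 2 (by norm_num) (by norm_num)).trans h2)
      ((hc 3 (by norm_num) (by norm_num)).trans h3) ((hc 4 (by norm_num) (by norm_num)).trans h4)
      ((hc 24 (by norm_num) (by norm_num)).trans h24) (hs₁.stores hw)
    refine ⟨s₂, (he₁.seq he₂).mono ?_, ⟨fun i hi hi' => ?_, fun i hi => ?_⟩, ?_⟩
    · have h1 := nestTime_le (2 * (levelCode d J).length + 1) hm J
      have h2 : m ^ J * (2 * (levelCode d J).length + 1 + 18 * J) ≤
          m ^ W * (2 * (levelCode d J).length + 1 + 18 * J) :=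
        Nat.mul_le_mul_right _ (Nat.pow_le_pow_right hm (by lia))
      have h3 : 1 ≤ m ^ W := Nat.one_le_pow _ _ hm
      calc _ ≤ K * m ^ W + m ^ W * (2 * (levelCode d J).length + 1 + 18 * J) + m ^ W := by lia
        _ = _ := by ring
    · rw [hs₂.1 i hi hi', hs₁.1 i hi hi']
    · rw [hs₂.2 i hi, hs₁.2 i hi]
    · rw [hr₂, hr₁, sum_range_succ, add_assoc]

/-- The program that adds to `R[0]` the expected number of forbidden configurations. -/
theorem exec_forbiddenProgram (d : ℕ) :
    ∃ K, ∀ (m : ℕ) (s : Memory) (w : Finset (Fin m) → ℝ), 1 ≤ m → s.nat 0 = m → s.nat 2 = 1 →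
      s.nat 3 = m * m → s.nat 4 = 16 → s.nat 24 = m → Stores m s w →
      ∃ s', Exec (forbiddenProgram d (7 + 3 * d / 2)) (K * m ^ (6 + 3 * d / 2)) s s' ∧
        SameOutsideLoops (6 + 3 * d / 2) s s' ∧
        s'.real 0 = s.real 0 + ∑ C ∈ forbidden (Fin m) d, ∏ A ∈ C, w A := by
  obtain ⟨K, hK⟩ := exec_forbiddenProgram_aux d (6 + 3 * d / 2) (7 + 3 * d / 2) (by lia)
  refine ⟨K, fun m s w hm h0 h2 h3 h4 h24 hw => ?_⟩
  rw [sum_forbidden_eq]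
  exact hK m s w hm h0 h2 h3 h4 h24 hw

/-! ### Storing numbers for triples -/

/-- Uniqueness of digits in base `m`; the leading digit `x` needs no bound. -/
lemma address_inj {m x y z x' y' z' : ℕ} (hy : y < m) (hz : z < m) (hy' : y' < m) (hz' : z' < m)
    (h : 16 + x * (m * m) + y * m + z = 16 + x' * (m * m) + y' * m + z') :
    x = x' ∧ y = y' ∧ z = z' := by
  have hm : 0 < m := by lia
  have h1 : (x * m + y) * m + z = (x' * m + y') * m + z' := by
    have e1 : (x * m + y) * m = x * (m * m) + y * m := by ring
    have e2 : (x' * m + y') * m = x' * (m * m) + y' * m := by ring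
    lia
  have key : ∀ {a b c c' : ℕ}, c < m → c' < m → a * m + c = b * m + c' → a = b ∧ c = c' := by
    intro a b c c' hc hc' h
    have h2 := congrArg (· % m) h
    simp only [Nat.mul_add_mod', Nat.mod_eq_of_lt hc, Nat.mod_eq_of_lt hc'] at h2
    subst h2
    exact ⟨Nat.eq_of_mul_eq_mul_right hm (by lia), rfl⟩
  obtain ⟨h2, h3⟩ := key hz hz' h1
  obtain ⟨h4, h5⟩ := key hy hy' h2
  exact ⟨h4, h5, h3⟩

lemma triple_inj {m : ℕ} {z y x z' y' x' : Fin m} (h1 : z < y) (h2 : y < x) (h1' : z' < y')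
    (h2' : y' < x') (h : ({z', y', x'} : Finset (Fin m)) = {z, y, x}) :
    z' = z ∧ y' = y ∧ x' = x := by
  have hz : z' ∈ ({z, y, x} : Finset (Fin m)) := h ▸ by simp
  have hy : y' ∈ ({z, y, x} : Finset (Fin m)) := h ▸ by simp
  have hx : x' ∈ ({z, y, x} : Finset (Fin m)) := h ▸ by simp
  simp only [mem_insert, mem_singleton] at hz hy hx
  lia

lemma Stores.update {m : ℕ} {s s' : Memory} {w : Finset (Fin m) → ℝ} (h : Stores m s w)
    {z y x : Fin m} (hzy : z < y) (hyx : y < x) {a : ℕ} (ha : a = 16 + x * (m * m) + y * m + z)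
    {v : ℝ} (hv : s'.real a = v) (hs : ∀ i, 16 ≤ i → i ≠ a → s'.real i = s.real i) :
    Stores m s' (Function.update w {z, y, x} v) := by
  subst ha
  intro z' y' x' hzy' hyx'
  by_cases heq : 16 + (x' : ℕ) * (m * m) + y' * m + z' = 16 + x * (m * m) + y * m + z
  · obtain ⟨h1, h2, h3⟩ := address_inj y'.2 z'.2 y.2 z.2 heq
    obtain rfl := Fin.ext h1
    obtain rfl := Fin.ext h2
    obtain rfl := Fin.ext h3
    rw [hv, Function.update_self]
  · rw [hs _ (by lia) heq, h z' y' x' hzy' hyx', Function.update_of_ne]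
    intro h
    obtain ⟨rfl, rfl, rfl⟩ := triple_inj hzy hyx hzy' hyx' h
    exact heq rfl

/-- Increasing triples correspond injectively to sets, so any memory content reads as a function on
triples. This starts the invariant of the initialization. -/
lemma exists_stores (m : ℕ) (s : Memory) : ∃ w, Stores m s w := by
  let I := {t : Fin m × Fin m × Fin m // t.1 < t.2.1 ∧ t.2.1 < t.2.2}
  let f : I → Finset (Fin m) := fun t => {t.1.1, t.1.2.1, t.1.2.2}
  have hf : f.Injective := fun t u h => by
    obtain ⟨h1, h2, h3⟩ := triple_inj u.2.1 u.2.2 t.2.1 t.2.2 h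
    exact Subtype.ext (Prod.ext h1 (Prod.ext h2 h3))
  let g : I → ℝ := fun t => s.real (16 + t.1.2.2 * (m * m) + t.1.2.1 * m + t.1.1)
  exact ⟨Function.extend f g 0, fun z y x hzy hyx =>
    (hf.extend_apply g 0 ⟨(z, y, x), hzy, hyx⟩).symm⟩

/-! ### Effect of one decision on the weights -/

lemma update_weight_zero {V : Type*} [DecidableEq V] {p : ℝ} {P R : Finset (Finset V)}
    {T : Finset V} (hP : T ∉ P) (hR : T ∉ R) :
    Function.update (weight p P (insert T R)) T 0 = weight p P R := by
  funext A
  by_cases h : A = T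
  · subst h; simp [weight, hP, hR]
  · simp [weight, h]

lemma update_weight_one {V : Type*} [DecidableEq V] {p : ℝ} {P R : Finset (Finset V)}
    {T : Finset V} : Function.update (weight p P R) T 1 = weight p (insert T P) R := by
  funext A
  by_cases h : A = T
  · subst h; simp [weight]
  · simp [weight, h]

lemma update_weight_insert_zero {V : Type*} [DecidableEq V] {p : ℝ} {P R : Finset (Finset V)}
    {T : Finset V} (hP : T ∉ P) (hR : T ∉ R) :
    Function.update (weight p (insert T P) R) T 0 = weight p P R := by
  funext A
  by_cases h : A = T
  · subst h; simp [weight, hP, hR]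
  · simp [weight, h]

/-- The cells that are constant during the main loop have the right contents. -/
structure Static (m W : ℕ) (p : ℝ) (s : Memory) : Prop where
  size : s.nat 0 = m
  start : s.nat 1 = 27 + 3 * W
  one : s.nat 2 = 1
  sq : s.nat 3 = m * m
  base : s.nat 4 = 16
  bound : s.nat 12 = m
  bound' : s.nat 24 = m
  prob : s.real 4 = p
  zeroR : s.real 5 = 0
  oneR : s.real 6 = 1

lemma Static.congr {m W : ℕ} {p : ℝ} {s s' : Memory} (h : Static m W p s)
    (hn : ∀ i, i < 5 ∨ i = 12 ∨ i = 24 → s'.nat i = s.nat i)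
    (hr : ∀ i, 4 ≤ i → i < 7 → s'.real i = s.real i) : Static m W p s' where
  size := (hn 0 (by lia)).trans h.size
  start := (hn 1 (by lia)).trans h.start
  one := (hn 2 (by lia)).trans h.one
  sq := (hn 3 (by lia)).trans h.sq
  base := (hn 4 (by lia)).trans h.base
  bound := (hn 12 (by lia)).trans h.bound
  bound' := (hn 24 (by lia)).trans h.bound'
  prob := (hr 4 (by lia) (by lia)).trans h.prob
  zeroR := (hr 5 (by lia) (by lia)).trans h.zeroR
  oneR := (hr 6 (by lia) (by lia)).trans h.oneR

lemma exists_of_mem_enum_three {m : ℕ} {l : List ℕ} (hl : l ∈ enum 3 m []) :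
    ∃ z y x : Fin m, z < y ∧ y < x ∧ l = [z.val, y.val, x.val] ∧ pointSet m l = {z, y, x} := by
  have h0 : (0 : Fin 3) < 1 := by decide
  have h1 : (1 : Fin 3) < 2 := by decide
  refine ⟨tupleEmb hl 0, tupleEmb hl 1, tupleEmb hl 2, tupleEmb_lt hl h0, tupleEmb_lt hl h1, ?_, ?_⟩
  · obtain ⟨a, b, c, rfl⟩ := List.length_eq_three.1 (mem_enum_nil.1 hl).1
    rfl
  · rw [pointSet_eq_map hl]
    ext v
    simp [Fin.exists_fin_succ, eq_comm]

/-- The instructions that put the address of the current triple of the main loop into `N[8]`. -/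
def addressCode : List Instr := [.addN 8 4 17, .addN 8 8 19, .addN 8 8 21]

lemma runBlock_addressCode {m : ℕ} {s : Memory} {z y x : Fin m} (h4 : s.nat 4 = 16)
    (hl : Levels m 12 s [z.val, y.val, x.val]) :
    (runBlock addressCode s).real = s.real ∧
      (runBlock addressCode s).nat 8 = 16 + x * (m * m) + y * m + z ∧
      ∀ i, i ≠ 8 → (runBlock addressCode s).nat i = s.nat i := by
  obtain ⟨h21, -, -, -, h19, -, -, -, h17, -⟩ := hl
  norm_num at h21 h19 h17
  refine ⟨rfl, ?_, fun i hi => ?_⟩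
  · simp [addressCode, runBlock, Instr.apply, h4, h21, h19, h17]
  · simp [addressCode, runBlock, Instr.apply, hi]

/-! ### The initialization -/

/-- The program that stores `R[4]` for all triples. -/
def initProgram : Program := nest (block (addressCode ++ [.storeR 8 4])) 3 12

/-- The invariant: every triple no longer waiting in the loop already has the value `p`. The body
has four instructions, hence the time `9 = 2 * 4 + 1`. -/
lemma exec_initProgram {m W : ℕ} {p : ℝ} {s : Memory} (hs : Static m W p s) :
    ∃ s', Exec initProgram (nestTime 9 m 3) s s' ∧ Static m W p s' ∧
      s'.nat 5 = s.nat 5 ∧ s'.nat 6 = s.nat 6 ∧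
      ∃ w, Stores m s' w ∧ ∀ T, T.card = 3 → w T = p := by
  obtain ⟨w₀, hw₀⟩ := exists_stores m s
  obtain ⟨s', he, hst, h5, h6, w, hw, hwp⟩ := exec_nest_nil (m := m) (b := 12) (K := 3) (t := 9)
    (body := block (addressCode ++ [.storeR 8 4]))
    (Inv := fun r s' => Static m W p s' ∧ s'.nat 5 = s.nat 5 ∧ s'.nat 6 = s.nat 6 ∧
      ∃ w, Stores m s' w ∧ ∀ T, T.card = 3 → T ∉ r.map (pointSet m) → w T = p)
    (by norm_num) (fun r s' h => ⟨h.1.size, h.1.one, h.1.sq⟩)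
    (fun r s₁ s₂ h hr hn => by
      refine ⟨h.1.congr (fun i hi => hn i (by lia)) (fun i _ _ => by rw [hr]),
        by rw [hn 5 (by lia), h.2.1], by rw [hn 6 (by lia), h.2.2.1], ?_⟩
      obtain ⟨w, hw, hwp⟩ := h.2.2.2
      exact ⟨w, fun z y x hzy hyx => by rw [hr, hw z y x hzy hyx], hwp⟩)
    (fun l r s₁ h hl hlev => by
      obtain ⟨z, y, x, hzy, hyx, rfl, hset⟩ := exists_of_mem_enum_three hl
      obtain ⟨h1, h5, h6, w, hw, hwp⟩ := h
      obtain ⟨g1, g2, g3⟩ := runBlock_addressCode h1.base hlev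
      have hn : ∀ i, i ≠ 8 → (runBlock (addressCode ++ [.storeR 8 4]) s₁).nat i = s₁.nat i :=
        fun i hi => by rw [runBlock_append]; exact g3 i hi
      have hr : (runBlock (addressCode ++ [.storeR 8 4]) s₁).real =
          Function.update s₁.real (16 + x * (m * m) + y * m + z) p := by
        rw [runBlock_append]
        simp only [runBlock, List.foldl_cons, List.foldl_nil, Instr.apply] at g1 g2 ⊢
        rw [g1, g2, h1.prob]
      refine ⟨_, (exec_block _ _).mono (by simp [addressCode]), ⟨h1.congr (fun i hi => hn i (by lia))
        (fun i hi hi' => ?_), by rw [hn _ (by norm_num), h5], by rw [hn _ (by norm_num), h6],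
        Function.update w {z, y, x} p, hw.update hzy hyx rfl ?_ ?_, ?_⟩, fun i hi hi' => hn i (by lia)⟩
      · rw [hr, Function.update_of_ne (by omega)]
      · rw [hr, Function.update_self]
      · intro i _ hi'
        rw [hr, Function.update_of_ne hi']
      · intro T hT hTr
        by_cases hTz : T = {z, y, x}
        · rw [hTz, Function.update_self]
        · rw [Function.update_of_ne hTz]
          refine hwp T hT ?_
          rw [List.map_cons, List.mem_cons, not_or, hset]
          exact ⟨hTz, hTr⟩)
    hs.bound ⟨hs, rfl, rfl, w₀, hw₀, fun T hT hTm => absurd (mem_map_pointSet.2 hT) hTm⟩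
  exact ⟨s', he, hst, h5, h6, w, hw, fun T hT => hwp T hT (by simp)⟩

/-! ### The main loop -/

/-- The triples of `P` are listed from the address `a` on. -/
def Listed (m a : ℕ) (s : Memory) (P : Finset (Finset (Fin m))) : Prop :=
  ∀ T : Finset (Fin m), T ∈ P ↔ ∃ j < P.card, T.map Fin.valEmbedding =
    {s.nat (a + 3 * j), s.nat (a + 3 * j + 1), s.nat (a + 3 * j + 2)}

lemma Listed.congr {m a : ℕ} {s s' : Memory} {P : Finset (Finset (Fin m))} (h : Listed m a s P)
    (hs : ∀ i, a ≤ i → i < a + 3 * P.card → s'.nat i = s.nat i) : Listed m a s' P := by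
  intro T
  rw [h T]
  refine exists_congr fun j => and_congr_right fun hj => ?_
  rw [hs _ (by lia) (by lia), hs _ (by lia) (by lia), hs _ (by lia) (by lia)]

lemma Listed.insert {m a : ℕ} {s s' : Memory} {P : Finset (Finset (Fin m))} (h : Listed m a s P)
    (hs : ∀ i, a ≤ i → i < a + 3 * P.card → s'.nat i = s.nat i) {z y x : Fin m}
    (hT : {z, y, x} ∉ P) (hz : s'.nat (a + 3 * P.card) = z) (hy : s'.nat (a + 3 * P.card + 1) = y)
    (hx : s'.nat (a + 3 * P.card + 2) = x) : Listed m a s' (insert {z, y, x} P) := by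
  intro T
  have hnew : T.map Fin.valEmbedding = {s'.nat (a + 3 * P.card), s'.nat (a + 3 * P.card + 1),
      s'.nat (a + 3 * P.card + 2)} ↔ T = {z, y, x} := by
    rw [hz, hy, hx, ← (map_injective Fin.valEmbedding).eq_iff]
    simp [map_insert]
  rw [mem_insert, card_insert_of_notMem hT, (h.congr hs) T, ← hnew]
  constructor
  · rintro (h | ⟨j, hj, h⟩)
    · exact ⟨_, Nat.lt_succ_self _, h⟩
    · exact ⟨j, by lia, h⟩
  · rintro ⟨j, hj, h⟩
    rcases Nat.lt_succ_iff_lt_or_eq.1 hj with hj | rfl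
    · exact Or.inr ⟨j, hj, h⟩
    · exact Or.inl h

/-- The state of the memory in the main loop, when the triples in `P` have been picked and those
in `R` are undecided. -/
structure MainState (m W : ℕ) (p : ℝ) (P R : Finset (Finset (Fin m))) (s : Memory) : Prop where
  static : Static m W p s
  count : s.nat 5 = P.card
  pointer : s.nat 6 = 27 + 3 * W + 3 * P.card
  listed : Listed m (27 + 3 * W) s P
  stores : Stores m s (weight p P R)

/-- The instructions that append the current triple to the output list. -/
def appendCode : List Instr :=
  [.storeN 6 21, .addN 6 6 2, .storeN 6 18, .addN 6 6 2, .storeN 6 15, .addN 6 6 2, .addN 5 5 2]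

/-- The decision about the current triple. -/
def decideProgram (d : ℕ) : Program :=
  .seq (block (addressCode ++ [.storeR 8 5, .addR 0 5 5]))
    (.seq (forbiddenProgram d (7 + 3 * d / 2))
      (.seq (block [.addR 7 0 6, .addR 0 5 5, .storeR 8 6])
        (.seq (forbiddenProgram d (7 + 3 * d / 2))
          (.branch (.ltR 0 7) (block appendCode) (block [.storeR 8 5])))))

/-- The weight of the current triple is set to `0`, the sum is computed, and one more than it is
saved in `R[7]`; then the weight is set to `1` and the sum recomputed in `R[0]`. By
`condExpectation_gt_iff` the test `R[0] < R[7]` is the decision. After picking, the weight is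
already correct; after rejection it is reset to `0`. -/
lemma exec_decideProgram (d : ℕ) : ∃ K, ∀ (m : ℕ) (p : ℝ) (P R : Finset (Finset (Fin m)))
    (z y x : Fin m) (s : Memory), 1 ≤ m → z < y → y < x → {z, y, x} ∉ P → {z, y, x} ∉ R →
    Disjoint P R → MainState m (6 + 3 * d / 2) p P (insert {z, y, x} R) s →
    Levels m 12 s [z.val, y.val, x.val] →
    ∃ s', Exec (decideProgram d) (K * m ^ (6 + 3 * d / 2)) s s' ∧
      MainState m (6 + 3 * d / 2) p (if condExpectation d p (insert {z, y, x} P) R >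
        condExpectation d p P R then insert {z, y, x} P else P) R s' ∧
      ∀ i, 12 ≤ i → i < 24 → s'.nat i = s.nat i := by
  obtain ⟨K, hK⟩ := exec_forbiddenProgram d
  refine ⟨2 * K + 50, fun m p P R z y x s hm hzy hyx hP hR hdisj hs hlev => ?_⟩
  simp only [condExpectation_gt_iff d p hP hR hdisj]
  set W := 6 + 3 * d / 2 with hW
  set T : Finset (Fin m) := {z, y, x} with hT
  set a := 16 + (x : ℕ) * (m * m) + y * m + z with ha
  have ha16 : 16 ≤ a := by omega
  clear_value a
  have htime : ∀ q, q ≤ 50 → 2 * (K * m ^ W) + q ≤ (2 * K + 50) * m ^ W := by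
    intro q hq
    have : 1 ≤ m ^ W := Nat.one_le_pow _ _ hm
    have e : (2 * K + 50) * m ^ W = 2 * (K * m ^ W) + 50 * m ^ W := by ring
    lia
  have hst := hs.static
  -- the triple is rejected
  set s₁ := runBlock (addressCode ++ [.storeR 8 5, .addR 0 5 5]) s with hs₁
  obtain ⟨g1, g2, g3⟩ := runBlock_addressCode hst.base hlev
  rw [← ha] at g2
  have n₁ : ∀ i, i ≠ 8 → s₁.nat i = s.nat i := fun i hi => by
    rw [hs₁, runBlock_append]; exact g3 i hi
  have n₁8 : s₁.nat 8 = a := by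
    rw [hs₁, runBlock_append]; exact g2
  have r₁ : s₁.real = Function.update (Function.update s.real a 0) 0 0 := by
    have h5 : 5 ≠ a := by lia
    rw [hs₁, runBlock_append, ← g1, ← g2]
    simp only [runBlock, List.foldl_cons, List.foldl_nil, Instr.apply] at g1 g2 ⊢
    rw [g1, g2, hst.zeroR, Function.update_of_ne h5, hst.zeroR, add_zero]
  have r₁' : ∀ i, i ≠ 0 → i ≠ a → s₁.real i = s.real i := fun i h h' => by
    rw [r₁, Function.update_of_ne h, Function.update_of_ne h']
  have st₁ : Static m W p s₁ := hst.congr (fun i hi => n₁ i (by lia))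
    fun i hi hi' => r₁' i (by lia) (by lia)
  have w₁ : Stores m s₁ (weight p P R) := by
    rw [← update_weight_zero hP hR]
    refine hs.stores.update hzy hyx ha ?_ fun i hi hi' => r₁' i (by lia) hi'
    rw [r₁, Function.update_of_ne (by lia), Function.update_self]
  obtain ⟨s₂, he₂, hf₂, hr₂⟩ := hK m s₁ _ hm st₁.size st₁.one st₁.sq st₁.base st₁.bound' w₁
  have st₂ : Static m W p s₂ := st₁.congr (fun i hi => hf₂.1 i (by lia) (by lia))
    fun i hi _ => hf₂.2 i hi
  -- the triple is picked
  set s₃ := runBlock [.addR 7 0 6, .addR 0 5 5, .storeR 8 6] s₂ with hs₃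
  have n₂8 : s₂.nat 8 = a := by rw [hf₂.1 8 (by lia) (by lia), n₁8]
  have n₃ : s₃.nat = s₂.nat := rfl
  have r₃ : s₃.real = Function.update (Function.update (Function.update s₂.real 7
      (s₂.real 0 + 1)) 0 0) a 1 := by
    simp only [hs₃, runBlock, List.foldl_cons, List.foldl_nil, Instr.apply, n₂8]
    simp [st₂.zeroR, st₂.oneR]
  have r₃' : ∀ i, i ≠ 7 → i ≠ 0 → i ≠ a → s₃.real i = s₂.real i := fun i h h' h'' => by
    rw [r₃, Function.update_of_ne h'', Function.update_of_ne h', Function.update_of_ne h]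
  have st₃ : Static m W p s₃ := st₂.congr (fun i hi => by rw [n₃])
    fun i hi hi' => r₃' i (by lia) (by lia) (by lia)
  have w₃ : Stores m s₃ (weight p (insert T P) R) := by
    rw [← update_weight_one]
    refine (hf₂.stores w₁).update hzy hyx ha ?_ fun i hi hi' => r₃' i (by lia) (by lia) hi'
    rw [r₃, Function.update_self]
  obtain ⟨s₄, he₄, hf₄, hr₄⟩ := hK m s₃ _ hm st₃.size st₃.one st₃.sq st₃.base st₃.bound' w₃
  have st₄ : Static m W p s₄ := st₃.congr (fun i hi => hf₄.1 i (by lia) (by lia))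
    fun i hi _ => hf₄.2 i hi
  have w₄ : Stores m s₄ (weight p (insert T P) R) := hf₄.stores w₃
  have n₄ : ∀ i, i ≠ 7 → i ≠ 8 → (i < 27 ∨ 27 + 3 * W ≤ i) → s₄.nat i = s.nat i :=
      fun i h h' h'' => by
    rw [hf₄.1 i h h'', n₃, hf₂.1 i h h'', n₁ i h']
  have n₄8 : s₄.nat 8 = a := by rw [hf₄.1 8 (by lia) (by lia), n₃, n₂8]
  have acc : s₄.real 0 = expForbidden d p (insert T P) R := by
    have : s₃.real 0 = 0 := by
      rw [r₃, Function.update_of_ne (by lia), Function.update_self]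
    rw [hr₄, this, zero_add]; rfl
  have sav : s₄.real 7 = expForbidden d p P R + 1 := by
    have h0 : s₁.real 0 = 0 := by rw [r₁, Function.update_self]
    rw [hf₄.2 7 (by lia), r₃, Function.update_of_ne (by lia), Function.update_of_ne (by lia),
      Function.update_self, hr₂, h0, zero_add]; rfl
  have hlist : Listed m (27 + 3 * W) s₄ P := hs.listed.congr fun i hi _ =>
    n₄ i (by lia) (by lia) (by lia)
  have run : ∀ {t s'}, Exec (.branch (.ltR 0 7) (block appendCode) (block [.storeR 8 5])) t s₄ s' →
      t ≤ 20 → Exec (decideProgram d) ((2 * K + 50) * m ^ W) s s' := by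
    intro t s' h ht
    refine ((exec_block _ s).seq (he₂.seq ((exec_block _ s₂).seq (he₄.seq h)))).mono ?_
    refine le_trans ?_ (htime 50 le_rfl)
    simp only [addressCode, List.length_append, List.length_cons, List.length_nil]
    lia
  by_cases hlt : expForbidden d p (insert T P) R < expForbidden d p P R + 1
  · rw [if_pos hlt]
    obtain ⟨h21, -, -, h18, -, -, h15, -⟩ := hlev
    norm_num at h21 h18 h15
    rw [← n₄ 21 (by lia) (by lia) (by lia)] at h21
    rw [← n₄ 18 (by lia) (by lia) (by lia)] at h18
    rw [← n₄ 15 (by lia) (by lia) (by lia)] at h15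
    have c6 : s₄.nat 6 = 27 + 3 * W + 3 * P.card := by
      rw [n₄ 6 (by lia) (by lia) (by lia), hs.pointer]
    have c5 : s₄.nat 5 = P.card := by rw [n₄ 5 (by lia) (by lia) (by lia), hs.count]
    set q := 27 + 3 * W + 3 * P.card with hq
    have hrun : (runBlock appendCode s₄).nat = Function.update (Function.update (Function.update
        (Function.update (Function.update s₄.nat 5 (P.card + 1)) 6 (q + 3)) q z) (q + 1) y)
        (q + 2) x := by
      funext i
      have q0 : q ≠ 0 := by lia
      -- The new list entry starts at `q ≥ 27`, so writing it disturbs neither the registers nor the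
      -- counters of the main loop.
      have e1 : ∀ b, b < 27 → b ≠ q ∧ b ≠ q + 1 ∧ b ≠ q + 2 ∧ q ≠ b ∧ q + 1 ≠ b ∧ q + 2 ≠ b :=
        fun b hb => by lia
      simp only [appendCode, runBlock, List.foldl_cons, List.foldl_nil, Instr.apply]
      simp only [Function.update_apply, c6, st₄.one, c5, h21, h18, h15, (e1 5 (by lia)).1,
        (e1 6 (by lia)).1, (e1 2 (by lia)).1, (e1 18 (by lia)).1, (e1 15 (by lia)).1,
        (e1 5 (by lia)).2.1, (e1 6 (by lia)).2.1, (e1 2 (by lia)).2.1, (e1 15 (by lia)).2.1,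
        if_true, if_false]
      norm_num
      by_cases i5 : i = 5
      · subst i5; simp [(e1 5 (by lia)).1, (e1 5 (by lia)).2.1, (e1 5 (by lia)).2.2.1, q0]
      · by_cases i6 : i = 6
        · subst i6
          simp [(e1 6 (by lia)).1, (e1 6 (by lia)).2.1, (e1 6 (by lia)).2.2.1, q0]
        · simp [i5, i6]
    have hother : ∀ i, i ≠ 5 → i ≠ 6 → i < q → (runBlock appendCode s₄).nat i = s₄.nat i := by
      intro i h5 h6 hi
      rw [hrun, Function.update_of_ne (by lia), Function.update_of_ne (by lia),
        Function.update_of_ne (by lia), Function.update_of_ne h6, Function.update_of_ne h5]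
    have hreal : (runBlock appendCode s₄).real = s₄.real := rfl
    refine ⟨_, run (.branch_true (by simpa only [Test.Holds, acc, sav] using hlt)
      (exec_block _ _)) (by simp [appendCode]), ?_, fun i hi hi' => ?_⟩
    · refine ⟨st₄.congr (fun i hi => hother i (by lia) (by lia) (by lia)) fun i _ _ => by rw [hreal],
        ?_, ?_, hlist.insert (fun i hi hi' => hother i (by lia) (by lia) (by lia)) hP ?_ ?_ ?_,
        fun z y x h h' => by rw [hreal, w₄ z y x h h']⟩
      · rw [hrun, card_insert_of_notMem hP, Function.update_of_ne (by lia),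
          Function.update_of_ne (by lia), Function.update_of_ne (by lia),
          Function.update_of_ne (by lia), Function.update_self]
      · rw [hrun, card_insert_of_notMem hP, Function.update_of_ne (by lia),
          Function.update_of_ne (by lia), Function.update_of_ne (by lia), Function.update_self]
        lia
      · rw [hrun, ← hq, Function.update_of_ne (by lia), Function.update_of_ne (by lia),
          Function.update_self]
      · rw [hrun, ← hq, Function.update_of_ne (by lia), Function.update_self]
      · rw [hrun, ← hq, Function.update_self]
    · rw [hother i (by lia) (by lia) (by lia), n₄ i (by lia) (by lia) (by lia)]
  · rw [if_neg hlt]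
    have hreal : (runBlock [.storeR 8 5] s₄).real = Function.update s₄.real a 0 := by
      simp only [runBlock, List.foldl_cons, List.foldl_nil, Instr.apply, n₄8, st₄.zeroR]
    have hnat : (runBlock [.storeR 8 5] s₄).nat = s₄.nat := rfl
    refine ⟨_, run (.branch_false (by simpa only [Test.Holds, acc, sav] using hlt)
      (exec_block _ _)) (by simp), ?_, fun i hi hi' => ?_⟩
    · refine ⟨st₄.congr (fun i hi => by rw [hnat]) fun i hi hi' => ?_, ?_, ?_,
        hlist.congr fun i _ _ => by rw [hnat], ?_⟩
      · rw [hreal, Function.update_of_ne (by lia)]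
      · rw [hnat, n₄ 5 (by lia) (by lia) (by lia), hs.count]
      · rw [hnat, n₄ 6 (by lia) (by lia) (by lia), hs.pointer]
      · rw [← update_weight_insert_zero hP hR]
        refine w₄.update hzy hyx ha ?_ fun i _ hi' => ?_
        · rw [hreal, Function.update_self]
        · rw [hreal, Function.update_of_ne hi']
    · rw [hnat, n₄ i (by lia) (by lia) (by lia)]

/-- The invariant: continuing the selection from the current `P` on the remaining triples gives the
final answer of the whole run. Three loops around a body of cost `O(m ^ (6 + 3 * d / 2))` give the
exponent. -/
lemma exec_mainLoop (d : ℕ) : ∃ K, ∀ (m : ℕ) (p : ℝ) (s : Memory), 1 ≤ m →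
    MainState m (6 + 3 * d / 2) p ∅ ((enum 3 m []).map (pointSet m)).toFinset s →
    ∃ s', Exec (nest (decideProgram d) 3 12) (K * m ^ (9 + 3 * d / 2)) s s' ∧
      MainState m (6 + 3 * d / 2) p
        (selectTriples d p ∅ ((enum 3 m []).map (pointSet m))) ∅ s' := by
  obtain ⟨K, hK⟩ := exec_decideProgram d
  refine ⟨K + 54, fun m p s hm hs => ?_⟩
  set W := 6 + 3 * d / 2 with hW
  obtain ⟨s', he, P, -, -, hsel, hmain⟩ := exec_nest_nil (m := m) (b := 12) (K := 3)
    (t := K * m ^ W) (body := decideProgram d)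
    (Inv := fun r s' => ∃ P, Disjoint P (r.map (pointSet m)).toFinset ∧
      (r.map (pointSet m)).Nodup ∧
      selectTriples d p P (r.map (pointSet m)) =
        selectTriples d p ∅ ((enum 3 m []).map (pointSet m)) ∧
      MainState m W p P (r.map (pointSet m)).toFinset s')
    (by norm_num)
    (fun r s' ⟨P, _, _, _, h⟩ => ⟨h.static.size, h.static.one, h.static.sq⟩)
    (fun r s₁ s₂ ⟨P, h1, h2, h3, h⟩ hr hn => by
      refine ⟨P, h1, h2, h3, h.static.congr (fun i hi => hn i (by lia)) (fun i _ _ => by rw [hr]),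
        ?_, ?_, h.listed.congr fun i hi _ => hn i (by lia), fun z y x hzy hyx => ?_⟩
      · rw [hn 5 (by lia), h.count]
      · rw [hn 6 (by lia), h.pointer]
      · rw [hr, h.stores z y x hzy hyx])
    (fun l r s₁ ⟨P, h1, h2, h3, h⟩ hl hlev => by
      obtain ⟨z, y, x, hzy, hyx, rfl, hset⟩ := exists_of_mem_enum_three hl
      rw [List.map_cons, hset] at h1 h2 h3 h
      rw [List.toFinset_cons] at h1 h
      rw [disjoint_insert_right] at h1
      rw [List.nodup_cons] at h2
      have hR : {z, y, x} ∉ (r.map (pointSet m)).toFinset := by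
        rw [List.mem_toFinset]; exact h2.1
      obtain ⟨s₂, he, hs₂, hf⟩ := hK m p P _ z y x s₁ hm hzy hyx h1.1 hR h1.2 h hlev
      refine ⟨s₂, he, ⟨_, ?_, h2.2, ?_, hs₂⟩, fun i hi hi' => hf i hi (by lia)⟩
      · split_ifs
        · exact disjoint_insert_left.2 ⟨hR, h1.2⟩
        · exact h1.2
      · rw [← h3, selectTriples]
        split_ifs <;> rfl)
    hs.static.bound ⟨∅, disjoint_empty_left _, nodup_map_pointSet 3 m, rfl, hs⟩
  rw [List.map_nil, selectTriples] at hsel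
  rw [hsel] at hmain
  refine ⟨s', he.mono ((nestTime_le _ hm 3).trans ?_), by simpa using hmain⟩
  have h1 : 1 ≤ m ^ W := Nat.one_le_pow _ _ hm
  have h2 : 9 + 3 * d / 2 = 3 + W := by lia
  calc m ^ 3 * (K * m ^ W + 18 * 3) ≤ m ^ 3 * (K * m ^ W + 54 * m ^ W) := 
        Nat.mul_le_mul_left _ (Nat.add_le_add_left (by lia) _)
    _ = _ := by rw [h2, pow_add]; ring

/-! ### The constants of the program -/

/-- The instructions that put `2 * (a / b) ^ (1 / k) * m ^ (-(e / k))` into `R[4]`. -/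
def probCode (a b k e : ℕ) : List Instr :=
  [.constN 8 a, .castR 4 8, .constN 8 b, .castR 7 8, .divR 4 4 7, .rootR 4 4 k, .addR 4 4 4,
    .castR 7 0, .rootR 7 7 k] ++ List.replicate e (.divR 4 4 7)

lemma runBlock_replicate_div (e : ℕ) (s : Memory) :
    runBlock (List.replicate e (.divR 4 4 7)) s =
      { s with real := Function.update s.real 4 (s.real 4 / s.real 7 ^ e) } := by
  induction e generalizing s with
  | zero => simp [runBlock]
  | succ e ih =>
    have : runBlock (List.replicate (e + 1) (.divR 4 4 7)) s =
        runBlock (List.replicate e (.divR 4 4 7)) (Instr.apply s (.divR 4 4 7)) := rfl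
    rw [this, ih]
    simp [Instr.apply, div_div, pow_succ']

lemma runBlock_probCode (a b k e : ℕ) (s : Memory) :
    (runBlock (probCode a b k e) s).real 4 =
        2 * ((a : ℝ) / b) ^ (1 / k : ℝ) * (s.nat 0 : ℝ) ^ (-(e / k) : ℝ) ∧
      (∀ i, i ≠ 8 → (runBlock (probCode a b k e) s).nat i = s.nat i) ∧
      ∀ i, i ≠ 4 → i ≠ 7 → (runBlock (probCode a b k e) s).real i = s.real i := by
  rw [probCode, runBlock_append, runBlock_replicate_div]
  refine ⟨?_, fun i hi => ?_, fun i hi hi' => ?_⟩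
  · have h1 : (0 : ℝ) ≤ (a : ℝ) / b := by positivity
    have h2 : (0 : ℝ) ≤ s.nat 0 := by positivity
    have h3 : (s.nat 0 : ℝ) ^ (-(e / k) : ℝ) = 1 / ((s.nat 0 : ℝ) ^ ((k : ℝ)⁻¹)) ^ e := by
      rw [Real.rpow_neg h2, ← Real.rpow_natCast, ← Real.rpow_mul h2, one_div, div_eq_inv_mul]
    rw [h3]
    simp [runBlock, Instr.apply, max_eq_left h1]
    ring
  · simp [runBlock, Instr.apply, hi]
  · simp [runBlock, Instr.apply, hi, hi']

/-- There is a straight-line program that computes the sampling probability. -/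
lemma exists_samplingProb_code (d : ℕ) : ∃ l : List Instr, ∀ s : Memory,
    (runBlock l s).real 4 = samplingProb (s.nat 0) d ∧
      (∀ i, i ≠ 8 → (runBlock l s).nat i = s.nat i) ∧
      ∀ i, i ≠ 4 → i ≠ 7 → (runBlock l s).real i = s.real i := by
  by_cases h2 : d = 2
  · refine ⟨probCode 1 1749 3 5, fun s => ⟨?_, (runBlock_probCode 1 1749 3 5 s).2⟩⟩
    rw [(runBlock_probCode 1 1749 3 5 s).1, samplingProb, if_pos h2]
    norm_num
  by_cases h3 : d = 3
  · refine ⟨probCode 15 378131 4 7, fun s => ⟨?_, (runBlock_probCode 15 378131 4 7 s).2⟩⟩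
    rw [(runBlock_probCode 15 378131 4 7 s).1, samplingProb, if_neg h2, if_pos h3]
    norm_num
  · refine ⟨probCode 30 10606681 5 9, fun s => ⟨?_, (runBlock_probCode 30 10606681 5 9 s).2⟩⟩
    rw [(runBlock_probCode 30 10606681 5 9 s).1, samplingProb, if_neg h2, if_neg h3]
    norm_num

/-- The instructions that initialize the constants; `W` is the maximal number of nested loops in
the search for forbidden configurations. -/
def constCode (W : ℕ) : List Instr :=
  [.constN 1 (27 + 3 * W), .constN 2 1, .constN 4 16, .addN 6 1 5, .addN 12 0 5, .addN 24 0 5,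
    .castR 6 2]

/-- The program that computes `N[3] := N[0] * N[0]`. -/
def squareProgram : Program := .loop (.ltN 7 0) (block [.addN 3 3 0, .addN 7 7 2])

/-- Multiplication by repeated addition, with `N[7]` counting rounds; `x` rounds are done and `q`
remain. -/
lemma exec_squareProgram {m : ℕ} (q x : ℕ) (s : Memory) (hx : x + q = m) (h0 : s.nat 0 = m)
    (h2 : s.nat 2 = 1) (h7 : s.nat 7 = x) :
    ∃ s', Exec squareProgram (6 * q + 1) s s' ∧ s'.nat 3 = s.nat 3 + q * m ∧
      (∀ i, i ≠ 3 → i ≠ 7 → s'.nat i = s.nat i) ∧ s'.real = s.real := by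
  induction q generalizing x s with
  | zero =>
    refine ⟨s, Exec.loop_false ?_, by simp, fun _ _ _ => rfl, rfl⟩
    simp only [Test.Holds, h7, h0]
    lia
  | succ q ih =>
    set s₁ := runBlock [.addN 3 3 0, .addN 7 7 2] s with hs₁
    have n₁ : ∀ i, i ≠ 3 → i ≠ 7 → s₁.nat i = s.nat i := fun i h h' => by
      simp [hs₁, runBlock, Instr.apply, h, h']
    have n3 : s₁.nat 3 = s.nat 3 + m := by simp [hs₁, runBlock, Instr.apply, h0]
    have n7 : s₁.nat 7 = x + 1 := by simp [hs₁, runBlock, Instr.apply, h7, h2]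
    obtain ⟨s', he, h3, hn, hr⟩ := ih (x + 1) s₁ (by lia) (by rw [n₁ 0 (by lia) (by lia), h0])
      (by rw [n₁ 2 (by lia) (by lia), h2]) n7
    refine ⟨s', (Exec.loop_true ?_ (exec_block _ s) he).mono ?_, ?_, fun i h h' => ?_, ?_⟩
    · simp only [Test.Holds, h7, h0]
      lia
    · simp only [List.length_cons, List.length_nil]
      lia
    · rw [h3, n3]
      ring
    · rw [hn i h h', n₁ i h h']
    · rw [hr]; rfl

/-! ### The whole program -/

/-- Squaring costs `O(m)` and initialization `O(m ^ 3)`, both dominated by the main loop. -/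
theorem exists_program (d : ℕ) : ∃ (c : Program) (K : ℕ), ∀ m : ℕ, 1 ≤ m →
    ∃ s : Memory, HaltsWithin c (inputMemory m) (K * m ^ (9 + 3 * d / 2)) s ∧
      Presents s (selectTriples d (samplingProb m d) ∅ ((enum 3 m []).map (pointSet m))) := by
  obtain ⟨code, hcode⟩ := exists_samplingProb_code d
  obtain ⟨K, hK⟩ := exec_mainLoop d
  set W := 6 + 3 * d / 2 with hW
  refine ⟨.seq (block (constCode W)) (.seq squareProgram (.seq (block code)
    (.seq initProgram (.seq (nest (decideProgram d) 3 12)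
      (block [.constN 0 0, .addN 0 0 5]))))),
    K + (100 + 2 * code.length), fun m hm => ?_⟩
  set p := samplingProb m d with hp
  set s₁ := runBlock (constCode W) (inputMemory m) with hs₁
  have k0 : s₁.nat 0 = m := by simp [hs₁, constCode, runBlock, Instr.apply, inputMemory]
  have k1 : s₁.nat 1 = 27 + 3 * W := by simp [hs₁, constCode, runBlock, Instr.apply, inputMemory]
  have k2 : s₁.nat 2 = 1 := by simp [hs₁, constCode, runBlock, Instr.apply, inputMemory]
  have k3 : s₁.nat 3 = 0 := by simp [hs₁, constCode, runBlock, Instr.apply, inputMemory]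
  have k4 : s₁.nat 4 = 16 := by simp [hs₁, constCode, runBlock, Instr.apply, inputMemory]
  have k5 : s₁.nat 5 = 0 := by simp [hs₁, constCode, runBlock, Instr.apply, inputMemory]
  have k6 : s₁.nat 6 = 27 + 3 * W := by simp [hs₁, constCode, runBlock, Instr.apply, inputMemory]
  have k7 : s₁.nat 7 = 0 := by simp [hs₁, constCode, runBlock, Instr.apply, inputMemory]
  have k12 : s₁.nat 12 = m := by simp [hs₁, constCode, runBlock, Instr.apply, inputMemory]
  have k24 : s₁.nat 24 = m := by simp [hs₁, constCode, runBlock, Instr.apply, inputMemory]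
  have q5 : s₁.real 5 = 0 := by simp [hs₁, constCode, runBlock, Instr.apply, inputMemory]
  have q6 : s₁.real 6 = 1 := by simp [hs₁, constCode, runBlock, Instr.apply, inputMemory]
  obtain ⟨s₂, he₂, hn3, hn₂, hr₂⟩ := exec_squareProgram m 0 s₁ (by lia) k0 k2 k7
  obtain ⟨c1, c2, c3⟩ := hcode s₂
  set s₃ := runBlock code s₂ with hs₃
  have n₃ : ∀ i, i ≠ 3 → i ≠ 7 → i ≠ 8 → s₃.nat i = s₁.nat i := fun i h h' h'' => by
    rw [c2 i h'', hn₂ i h h']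
  have st₃ : Static m W p s₃ :=
    { size := by rw [n₃ 0 (by lia) (by lia) (by lia), k0]
      start := by rw [n₃ 1 (by lia) (by lia) (by lia), k1]
      one := by rw [n₃ 2 (by lia) (by lia) (by lia), k2]
      sq := by rw [c2 3 (by lia), hn3, k3, zero_add]
      base := by rw [n₃ 4 (by lia) (by lia) (by lia), k4]
      bound := by rw [n₃ 12 (by lia) (by lia) (by lia), k12]
      bound' := by rw [n₃ 24 (by lia) (by lia) (by lia), k24]
      prob := by rw [c1, hn₂ 0 (by lia) (by lia), k0]
      zeroR := by rw [c3 5 (by lia) (by lia), hr₂, q5]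
      oneR := by rw [c3 6 (by lia) (by lia), hr₂, q6] }
  obtain ⟨s₄, he₄, st₄, h5, h6, w, hw, hwp⟩ := exec_initProgram st₃
  have main₄ : MainState m W p ∅ ((enum 3 m []).map (pointSet m)).toFinset s₄ :=
    { static := st₄
      count := by rw [h5, n₃ 5 (by lia) (by lia) (by lia), k5, card_empty]
      pointer := by rw [h6, n₃ 6 (by lia) (by lia) (by lia), k6, card_empty, mul_zero, add_zero]
      listed := fun T => by simp
      stores := fun z y x hzy hyx => by
        have hcard : ({z, y, x} : Finset (Fin m)).card = 3 := by
          rw [card_eq_three]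
          exact ⟨z, y, x, hzy.ne, (hzy.trans hyx).ne, hyx.ne, rfl⟩
        rw [hw z y x hzy hyx, hwp _ hcard, weight, if_neg (notMem_empty _), if_pos]
        rw [List.mem_toFinset, mem_map_pointSet, hcard] }
  obtain ⟨s₅, he₅, main₅⟩ := hK m p s₄ hm main₄
  -- `N[0]` holds `m` during the whole run, so only now can it receive the number of listed triples.
  set s₆ := runBlock [.constN 0 0, .addN 0 0 5] s₅ with hs₆
  have n₆ : ∀ i, i ≠ 0 → s₆.nat i = s₅.nat i := fun i h => by
    simp [hs₆, runBlock, Instr.apply, h]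
  have n0 : s₆.nat 0 = s₅.nat 5 := by simp [hs₆, runBlock, Instr.apply]
  refine ⟨s₆, (((exec_block _ _).seq (he₂.seq ((exec_block _ _).seq (he₄.seq (he₅.seq
    (exec_block _ _)))))).mono ?_).haltsWithin, ?_, ?_⟩
  · have h1 : 1 ≤ m ^ (6 + 3 * d / 2) := Nat.one_le_pow _ _ hm
    have h2 : m ≤ m ^ (9 + 3 * d / 2) := Nat.le_self_pow (by lia) m
    have h3 : m ^ 3 ≤ m ^ (9 + 3 * d / 2) := Nat.pow_le_pow_right hm (by lia)
    have h4 : 1 ≤ m ^ (9 + 3 * d / 2) := Nat.one_le_pow _ _ hm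
    have h5 := nestTime_le 9 hm 3
    have h6 : (K + (100 + 2 * code.length)) * m ^ (9 + 3 * d / 2) = K * m ^ (9 + 3 * d / 2) +
      100 * m ^ (9 + 3 * d / 2) + 2 * (code.length * m ^ (9 + 3 * d / 2)) := by ring
    have h7 : code.length ≤ code.length * m ^ (9 + 3 * d / 2) := Nat.le_mul_of_pos_right _ h4
    rw [h6]
    simp only [constCode, List.length_cons, List.length_nil]
    lia
  · rw [n0, main₅.count]
  · intro T
    have hl := (main₅.listed.congr (s' := s₆) fun i hi _ => n₆ i (by lia)) T
    rw [n0, main₅.count, n₆ 1 (by lia), main₅.static.start]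
    exact hl

/-- For a natural number `n`, `⌈(n - 1)/2⌉ = ⌊n/2⌋` by parity. The case `q = 0` is separate because
a zero value of `Nat.ceil` only says that its argument is nonpositive. -/
lemma ceil_eq (d : ℕ) : ⌈(3 * (d : ℚ) - 1) / 2⌉₊ = 3 * d / 2 := by
  have h := Nat.div_add_mod (3 * d) 2
  have hlt := Nat.mod_lt (3 * d) (show 2 > 0 by norm_num)
  set q := 3 * d / 2 with hq
  have hd : (3 * d : ℚ) = 2 * q + ((3 * d) % 2 : ℕ) := by exact_mod_cast h.symm
  have h1 : ((3 * d % 2 : ℕ) : ℚ) ≤ 1 := by exact_mod_cast Nat.lt_succ_iff.1 hlt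
  have h0 : (0 : ℚ) ≤ ((3 * d % 2 : ℕ) : ℚ) := by positivity
  rcases Nat.eq_zero_or_pos q with hq0 | hq0
  · rw [hq0, Nat.ceil_eq_zero]
    rw [hq0] at hd
    push_cast at hd
    linarith
  · rw [Nat.ceil_eq_iff hq0.ne', Nat.cast_sub hq0]
    push_cast
    constructor <;> linarith

end XCode
end

/-! ### The theorem -/

theorem mainTheorem3 (d : ℕ) (hd : 2 ≤ d) :
    -- for every order of the triples the algorithm has an output, and every possible output is an
    -- X-code of constant weight three
    (∀ (m : ℕ) (L : List (Finset (Fin m))), XCode.IsTripleOrder L →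
      (∃ B, XCode.IsAlgorithmOutput m d L B) ∧
      ∀ B, XCode.IsAlgorithmOutput m d L B →
        XCode.IsXCode d 2 (XCode.incidenceMatrix B) ∧
        XCode.HasConstantWeight 3 (XCode.incidenceMatrix B)) ∧
    -- for sufficiently large `m`, every possible output has the guaranteed number of codewords
    (∃ m₀ : ℕ, ∀ m ≥ m₀, ∀ (L : List (Finset (Fin m))), XCode.IsTripleOrder L →
      ∀ B, XCode.IsAlgorithmOutput m d L B → XCode.codewordBound m d ≤ (B.card : ℝ)) ∧
    -- for fixed `d`, the algorithm is carried out by a program in time `O(m^(9+⌈(3d-1)/2⌉))`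
    (∃ (c : XCode.Program) (K : ℕ), ∀ m : ℕ, 1 ≤ m →
      ∃ (s : XCode.Memory) (L : List (Finset (Fin m))) (B : Finset (Finset (Fin m))),
        XCode.HaltsWithin c (XCode.inputMemory m)
          (K * m ^ (9 + ⌈((3 * (d : ℚ) - 1) / 2)⌉₊)) s ∧
        XCode.Presents s B ∧
        XCode.IsTripleOrder L ∧
        XCode.IsAlgorithmOutput m d L B) := by
  refine ⟨fun m L hL => XCode.algorithm_correct m d L hL, XCode.codewordBound_le_card d hd, ?_⟩
  obtain ⟨c, K, h⟩ := XCode.exists_program d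
  refine ⟨c, K, fun m hm => ?_⟩
  obtain ⟨s, hs, hB⟩ := h m hm
  rw [XCode.ceil_eq]
  exact ⟨s, _, _, hs, hB, XCode.isTripleOrder_enum m,
    (XCode.isAlgorithmOutput_iff (XCode.isTripleOrder_enum m) _).2 rfl⟩
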